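/- Let $n\ge 0$ be an integer, let $\mathbb T^{2n}=\mathbb R^{2n}/\mathbb Z^{2n}$ with Lebesgue measure of total mass $1$, and let $f\in C^\infty(\mathbb T^{2n};\mathbb C)$, regarded as a $\mathbb Z^{2n}$-periodic function of $(x,\xi)\in\mathbb R^n\times\mathbb R^n$. For an integer $N\ge 1$ put $h=1/(2\pi N)$ and $$Q_j=N^{-n/2}\sum_{\ell\in\mathbb Z^n}\delta(x-\ell-j/N)\in\mathcal S'(\mathbb R^n),\qquad j\in(\mathbb Z/N\mathbb Z)^n,$$ and let $f_N\in M_{N^n}(\mathbb C)$ be the matrix, in the (linearly independent, declared orthonormal) system $(Q_j)$, of the Weyl quantization $$[f^w(x,hD)u](x)=\frac1{(2\pi h)^n}\iint f\Big(\frac{x+y}2,\xi\Big)e^{\frac ih\langle x-y,\xi\rangle}u(y)\,dy\,d\xi$$ extended to $\mathcal S'(\mathbb R^n)$ by duality, that is $f^w(x,hD)Q_j=\sum_m (f_N)_{mj}Q_m$; this matrix exists and is unique. Let $f_N^*$ be its conjugate transpose, and define $\psi(A)$ for a self-adjoint matrix $A$ by the functional calculus. Suppose that for some $\kappa>0$ $$\mathrm{vol}_{\mathbb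 T^{2n}}\big(\{w:|f(w)|\le t\}\big)=\mathcal O(t^\kappa),\qquad 0\le t\ll1 .$$ Let $\rho<1/2$ and let $K\subset\mathbb R$ be compact. Then there are constants $C>0$ and $\alpha_0>0$ (depending only on $n,f,\kappa,\rho,K$) such that for every $\psi\in C_c^\infty(\mathbb R;\mathbb C)$ with $\operatorname{supp}\psi\subset K$, every $N\ge1$ and every $\alpha$ with $N^{-\rho}\le\alpha\le\alpha_0$, $$\operatorname{rank}\,\psi\!\left(\frac{f_Nf_N^*}{\alpha^2}\right)\le C\,N^n\,\alpha^\kappa .$$ -/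

import Mathlib

open scoped ContDiff SchwartzMap

noncomputable section

namespace TorusQuantization

/-- Smooth complex-valued functions on `𝕋²ⁿ = ℝ²ⁿ / ℤ²ⁿ`, identified with smooth
`ℤ²ⁿ`-periodic functions of `(x, ξ) ∈ ℝⁿ × ℝⁿ`. -/
structure IsSmoothOnTorus {n : ℕ}
    (f : EuclideanSpace ℝ (Fin n) × EuclideanSpace ℝ (Fin n) → ℂ) : Prop where
  contDiff : ContDiff ℝ ∞ f
  periodic : ∀ (k l : Fin n → ℤ) (x ξ : EuclideanSpace ℝ (Fin n)),
    f (x + WithLp.toLp 2 (fun i => (k i : ℝ)), ξ + WithLp.toLp 2 (fun i => (l i : ℝ))) = f (x, ξ)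

/-- The fundamental domain `[0,1)²ⁿ` of the torus; it has Lebesgue measure one. -/
def fundamentalCube (n : ℕ) : Set (EuclideanSpace ℝ (Fin n) × EuclideanSpace ℝ (Fin n)) :=
  {w | ∀ i, w.1 i ∈ Set.Ico (0 : ℝ) 1 ∧ w.2 i ∈ Set.Ico (0 : ℝ) 1}

/-- `vol_{𝕋²ⁿ} {w : |f(w) - z| ≤ t} = O(t^κ)` for `0 ≤ t ≪ 1`. -/
def SublevelVolumeBound {n : ℕ}
    (f : EuclideanSpace ℝ (Fin n) × EuclideanSpace ℝ (Fin n) → ℂ) (z : ℂ) (κ : ℝ) : Prop :=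
  ∃ C t₀ : ℝ, 0 < t₀ ∧ ∀ t : ℝ, 0 ≤ t → t ≤ t₀ →
    MeasureTheory.volume {w | w ∈ fundamentalCube n ∧ ‖f w - z‖ ≤ t} ≤ ENNReal.ofReal (C * t ^ κ)

/-- The `h`-Weyl quantization `aʷ(x, hD)` acting on a function `u`:
`(2πh)⁻ⁿ ∫ (∫ a((x+y)/2, ξ) exp((i/h)⟨x-y, ξ⟩) u(y) dy) dξ`.
The integral is iterated (first in `y`): for a bounded smooth symbol with bounded derivatives
and a Schwartz function `u`, the inner integral is rapidly decreasing in `ξ`. -/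
def weylOp {n : ℕ} (h : ℝ) (a : EuclideanSpace ℝ (Fin n) × EuclideanSpace ℝ (Fin n) → ℂ)
    (u : EuclideanSpace ℝ (Fin n) → ℂ) (x : EuclideanSpace ℝ (Fin n)) : ℂ :=
  (((2 * Real.pi * h) ^ n)⁻¹ : ℝ) *
    ∫ ξ : EuclideanSpace ℝ (Fin n), ∫ y : EuclideanSpace ℝ (Fin n),
      a ((1 / 2 : ℝ) • (x + y), ξ) *
        Complex.exp (Complex.I * ((inner ℝ (x - y) ξ / h : ℝ) : ℂ)) * u y

/-- The formal transpose of `aʷ(x, hD)`, which is the Weyl quantization of `a(x, -ξ)`. -/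
def weylTranspose {n : ℕ} (h : ℝ) (a : EuclideanSpace ℝ (Fin n) × EuclideanSpace ℝ (Fin n) → ℂ)
    (u : EuclideanSpace ℝ (Fin n) → ℂ) : EuclideanSpace ℝ (Fin n) → ℂ :=
  weylOp h (fun w => a (w.1, -w.2)) u

/-- The distribution `Q_j = N^{-n/2} ∑_{ℓ ∈ ℤⁿ} δ(x - ℓ - j/N)`, `j ∈ (ℤ/Nℤ)ⁿ`, evaluated on a
function `φ`. The points `ℓ + j/N`, `ℓ ∈ ℤⁿ`, are the points `k/N` with `k ∈ ℤⁿ`, `k ≡ j mod N`. -/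
def comb {n : ℕ} (N : ℕ) (j : Fin n → ZMod N) (φ : EuclideanSpace ℝ (Fin n) → ℂ) : ℂ :=
  ((Real.sqrt ((N : ℝ) ^ n))⁻¹ : ℝ) *
    ∑' k : {k : Fin n → ℤ // ∀ i, (k i : ZMod N) = j i},
      φ (WithLp.toLp 2 (fun i => (k.1 i : ℝ) / N))

/-- `F` is the matrix of `fʷ(x, hD)`, `h = 1/(2πN)`, in the basis `Q_j`, `j ∈ (ℤ/Nℤ)ⁿ`:
`fʷ(x, hD) Q_j = ∑_m F_{mj} Q_m` as tempered distributions. The operator acts on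
distributions by duality, `⟨fʷ Q_j, φ⟩ = ⟨Q_j, (fʷ)ᵗ φ⟩` for all Schwartz functions `φ`. -/
def IsQuantizationMatrix {n : ℕ}
    (f : EuclideanSpace ℝ (Fin n) × EuclideanSpace ℝ (Fin n) → ℂ) (N : ℕ) [NeZero N]
    (F : Matrix (Fin n → ZMod N) (Fin n → ZMod N) ℂ) : Prop :=
  ∀ (j : Fin n → ZMod N) (φ : 𝓢(EuclideanSpace ℝ (Fin n), ℂ)),
    comb N j (weylTranspose (1 / (2 * Real.pi * N)) f φ) = ∑ m, F m j * comb N m φ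

open Classical in
/-- The quantization `f ↦ f_N` of the torus: the matrix of `fʷ(x, hD)`, `h = 1/(2πN)`, restricted
to the span of the `Q_j`, in the basis `(Q_j)`, which is taken to be orthonormal. For `f` smooth on
the torus this matrix exists and is unique. -/
def quantize {n : ℕ} (f : EuclideanSpace ℝ (Fin n) × EuclideanSpace ℝ (Fin n) → ℂ)
    (N : ℕ) [NeZero N] : Matrix (Fin n → ZMod N) (Fin n → ZMod N) ℂ :=
  if h : ∃ F, IsQuantizationMatrix f N F then h.choose else 0

/-- `ψ(A)` for a self-adjoint matrix `A` and a complex-valued function `ψ` on the line, by the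
functional calculus of self-adjoint matrices applied to the real and imaginary parts of `ψ`. -/
def matrixFun {ι : Type*} [Fintype ι] [DecidableEq ι] (ψ : ℝ → ℂ) (A : Matrix ι ι ℂ) :
    Matrix ι ι ℂ :=
  cfc (fun t => (ψ t).re) A + Complex.I • cfc (fun t => (ψ t).im) A

/-! The rest of the file shows that the matrix which defines `quantize` exists and is unique. -/

section WellDefined

open MeasureTheory
open scoped FourierTransform RealInnerProductSpace

variable {n : ℕ}

/-- `exp(2πit)`. -/
def exp2pi (t : ℝ) : ℂ := Complex.exp (((2 * Real.pi * t : ℝ) : ℂ) * Complex.I)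
lemma exp2pi_add (s t : ℝ) : exp2pi (s + t) = exp2pi s * exp2pi t := by
  rw [exp2pi, exp2pi, exp2pi, ← Complex.exp_add]; congr 1; push_cast; ring
lemma norm_exp2pi (t : ℝ) : ‖exp2pi t‖ = 1 := Complex.norm_exp_ofReal_mul_I _
lemma continuous_exp2pi : Continuous exp2pi := by unfold exp2pi; fun_prop
lemma exp2pi_int (m : ℤ) : exp2pi m = 1 := by
  rw [exp2pi, Complex.exp_eq_one_iff]; exact ⟨m, by push_cast; ring⟩

lemma fourier_exp2pi (φ : 𝓢(EuclideanSpace ℝ (Fin n), ℂ)) (w : EuclideanSpace ℝ (Fin n)) : (𝓕 φ : 𝓢(EuclideanSpace ℝ (Fin n), ℂ)) w = ∫ v, exp2pi (-⟪v, w⟫) * φ v := by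
  rw [SchwartzMap.fourier_coe, Real.fourier_eq']
  simp [exp2pi]
lemma fourierInv_exp2pi (φ : 𝓢(EuclideanSpace ℝ (Fin n), ℂ)) (w : EuclideanSpace ℝ (Fin n)) : φ w = ∫ v, exp2pi ⟪v, w⟫ * (𝓕 φ : 𝓢(EuclideanSpace ℝ (Fin n), ℂ)) v := by
  conv_lhs => rw [← FourierTransform.fourierInv_fourier_eq (F := 𝓢(EuclideanSpace ℝ (Fin n), ℂ)) φ]
  rw [SchwartzMap.fourierInv_coe, Real.fourierInv_eq']
  simp [exp2pi]

def intVec (k : Fin n → ℤ) : EuclideanSpace ℝ (Fin n) := WithLp.toLp 2 (fun i => (k i : ℝ))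

def weylTerm (N : ℕ) (x : EuclideanSpace ℝ (Fin n)) (φ : 𝓢(EuclideanSpace ℝ (Fin n), ℂ)) (l m ξ y : EuclideanSpace ℝ (Fin n)) : ℂ :=
  exp2pi (⟪l, (1 / 2 : ℝ) • (x + y)⟫ - ⟪m, ξ⟫) * exp2pi (N * ⟪x - y, ξ⟫) * φ y

lemma norm_weylTerm (N : ℕ) (x : EuclideanSpace ℝ (Fin n)) (φ : 𝓢(EuclideanSpace ℝ (Fin n), ℂ)) (l m ξ y : EuclideanSpace ℝ (Fin n)) :
    ‖weylTerm N x φ l m ξ y‖ = ‖φ y‖ := by simp [weylTerm, norm_exp2pi]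

lemma integrable_weylTerm (N : ℕ) (x : EuclideanSpace ℝ (Fin n)) (φ : 𝓢(EuclideanSpace ℝ (Fin n), ℂ)) (l m ξ : EuclideanSpace ℝ (Fin n)) :
    Integrable (fun y => weylTerm N x φ l m ξ y) := by
  refine (φ.integrable (μ := volume)).mono ?_ (Filter.Eventually.of_forall fun y => (norm_weylTerm _ _ _ _ _ _ _).le)
  apply Continuous.aestronglyMeasurable
  have := continuous_exp2pi
  have := φ.continuous
  unfold weylTerm
  fun_prop

def innerIntegral (N : ℕ) (x : EuclideanSpace ℝ (Fin n)) (φ : 𝓢(EuclideanSpace ℝ (Fin n), ℂ)) (l m η : EuclideanSpace ℝ (Fin n)) : ℂ :=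
  exp2pi (⟪l, x⟫ / 2) * (exp2pi (⟪η + (1 / 2 : ℝ) • l, x - (N : ℝ)⁻¹ • m⟫) * (𝓕 φ : 𝓢(EuclideanSpace ℝ (Fin n), ℂ)) η)

lemma norm_innerIntegral (N : ℕ) (x : EuclideanSpace ℝ (Fin n)) (φ : 𝓢(EuclideanSpace ℝ (Fin n), ℂ)) (l m η : EuclideanSpace ℝ (Fin n)) :
    ‖innerIntegral N x φ l m η‖ = ‖(𝓕 φ : 𝓢(EuclideanSpace ℝ (Fin n), ℂ)) η‖ := by simp [innerIntegral, norm_exp2pi]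

lemma integral_weylTerm (N : ℕ) [NeZero N] (x : EuclideanSpace ℝ (Fin n)) (φ : 𝓢(EuclideanSpace ℝ (Fin n), ℂ)) (l m ξ : EuclideanSpace ℝ (Fin n)) :
    ∫ y, weylTerm N x φ l m ξ y =
      innerIntegral N x φ l m ((N : ℝ) • ξ - (1 / 2 : ℝ) • l) := by
  have hN : (N : ℝ) ≠ 0 := by exact_mod_cast NeZero.ne N
  simp only [innerIntegral, sub_add_cancel]
  rw [fourier_exp2pi, ← mul_assoc, ← integral_const_mul]
  congr 1; funext y
  rw [weylTerm, ← mul_assoc, ← exp2pi_add, ← exp2pi_add, ← exp2pi_add]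
  congr 2
  simp only [inner_sub_left, inner_sub_right, inner_add_right, real_inner_smul_left,
    real_inner_smul_right]
  rw [real_inner_comm ξ x, real_inner_comm m ξ, real_inner_comm l y]
  field_simp
  ring

lemma integrable_innerIntegral (N : ℕ) [NeZero N] (x : EuclideanSpace ℝ (Fin n)) (φ : 𝓢(EuclideanSpace ℝ (Fin n), ℂ)) (l m : EuclideanSpace ℝ (Fin n)) :
    Integrable (innerIntegral N x φ l m) := by
  refine ((𝓕 φ : 𝓢(EuclideanSpace ℝ (Fin n), ℂ)).integrable (μ := volume)).mono ?_ (Filter.Eventually.of_forall fun y => (norm_innerIntegral _ _ _ _ _ _).le)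
  apply Continuous.aestronglyMeasurable
  have := continuous_exp2pi
  have := (𝓕 φ : 𝓢(EuclideanSpace ℝ (Fin n), ℂ)).continuous
  unfold innerIntegral
  fun_prop

lemma integral_affine (N : ℕ) {F : Type*} [NormedAddCommGroup F] [NormedSpace ℝ F] (H : EuclideanSpace ℝ (Fin n) → F) (v : EuclideanSpace ℝ (Fin n)) :
    ∫ ξ, H ((N : ℝ) • ξ - v) = ((N : ℝ) ^ n)⁻¹ • ∫ η, H η := by
  rw [Measure.integral_comp_smul volume (fun η => H (η - v)) (N : ℝ), integral_sub_right_eq_self,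
    abs_of_nonneg (by positivity)]
  simp

lemma weylTranspose_hasSum {ι : Type*} [Countable ι] (N : ℕ) [NeZero N] (f : EuclideanSpace ℝ (Fin n) × EuclideanSpace ℝ (Fin n) → ℂ)
    (c : ι → ℂ) (l m : ι → EuclideanSpace ℝ (Fin n)) (hc : Summable fun q => ‖c q‖)
    (hf : ∀ x ξ, HasSum (fun q => c q * exp2pi (⟪l q, x⟫ + ⟪m q, ξ⟫)) (f (x, ξ)))
    (φ : 𝓢(EuclideanSpace ℝ (Fin n), ℂ)) (x : EuclideanSpace ℝ (Fin n)) :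
    weylTranspose (1 / (2 * Real.pi * N)) f φ x =
      ∑' q, c q * (exp2pi (⟪l q, x⟫ - ⟪l q, (N : ℝ)⁻¹ • m q⟫ / 2) * φ (x - (N : ℝ)⁻¹ • m q)) := by
  have hN : (N : ℝ) ≠ 0 := by exact_mod_cast NeZero.ne N
  have hpi := Real.pi_pos.ne'
  have h1 : ∀ ξ y, f ((1 / 2 : ℝ) • (x + y), -ξ) *
        Complex.exp (Complex.I * ((⟪x - y, ξ⟫ / (1 / (2 * Real.pi * N)) : ℝ) : ℂ)) * φ y
      = ∑' q, c q * weylTerm N x φ (l q) (m q) ξ y := by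
    intro ξ y
    have e : Complex.exp (Complex.I * ((⟪x - y, ξ⟫ / (1 / (2 * Real.pi * N)) : ℝ) : ℂ)) = exp2pi (N * ⟪x - y, ξ⟫) := by
      rw [exp2pi, mul_comm]; congr 3; field_simp
    rw [e]
    have := ((hf ((1 / 2 : ℝ) • (x + y)) (-ξ)).mul_right (exp2pi (N * ⟪x - y, ξ⟫))).mul_right (φ y)
    rw [← this.tsum_eq]
    congr 1; funext q
    rw [weylTerm, inner_neg_right, ← sub_eq_add_neg]; ring
  have h2 : ∀ ξ, ∫ y, f ((1 / 2 : ℝ) • (x + y), -ξ) *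
        Complex.exp (Complex.I * ((⟪x - y, ξ⟫ / (1 / (2 * Real.pi * N)) : ℝ) : ℂ)) * φ y
      = ∑' q, c q * ∫ y, weylTerm N x φ (l q) (m q) ξ y := by
    intro ξ
    simp_rw [h1]
    rw [← integral_tsum_of_summable_integral_norm (fun q => (integrable_weylTerm N x φ (l q) (m q) ξ).const_mul (c q))]
    · simp_rw [integral_const_mul]
    · simp_rw [norm_mul, norm_weylTerm, integral_const_mul]
      exact hc.mul_right _
  unfold weylTranspose weylOp
  simp_rw [h2, integral_weylTerm]
  rw [← integral_tsum_of_summable_integral_norm]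
  · simp_rw [integral_const_mul]
    rw [← tsum_mul_left]
    congr 1; funext q
    rw [integral_affine N (innerIntegral N x φ (l q) (m q)) ((1 / 2 : ℝ) • l q)]
    have h3 : ∫ η : EuclideanSpace ℝ (Fin n), innerIntegral N x φ (l q) (m q) η
        = exp2pi (⟪l q, x⟫ - ⟪l q, (N : ℝ)⁻¹ • m q⟫ / 2) * φ (x - (N : ℝ)⁻¹ • m q) := by
      rw [fourierInv_exp2pi φ, ← integral_const_mul]
      congr 1; funext η
      rw [innerIntegral, ← mul_assoc, ← mul_assoc, ← exp2pi_add, ← exp2pi_add]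
      congr 2
      rw [inner_add_left, real_inner_smul_left, inner_sub_right (l q)]
      ring
    rw [h3]
    have h4 : ((2 * Real.pi * (1 / (2 * Real.pi * N))) ^ n)⁻¹ = (N : ℝ) ^ n := by
      have : 2 * Real.pi * (1 / (2 * Real.pi * N)) = (N : ℝ)⁻¹ := by field_simp
      rw [this, inv_pow, inv_inv]
    rw [h4, Complex.real_smul]
    have h5 : (((N : ℝ) ^ n : ℝ) : ℂ) ≠ 0 := by exact_mod_cast pow_ne_zero n hN
    rw [Complex.ofReal_inv]
    field_simp
  · intro q
    refine Integrable.const_mul ?_ _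
    exact ((integrable_innerIntegral N x φ (l q) (m q)).comp_sub_right ((1 / 2 : ℝ) • l q)).comp_smul hN
  · have h6 : ∀ q, ∫ ξ : EuclideanSpace ℝ (Fin n), ‖c q * innerIntegral N x φ (l q) (m q) ((N : ℝ) • ξ - (1 / 2 : ℝ) • l q)‖
        = ‖c q‖ * (((N : ℝ) ^ n)⁻¹ * ∫ η : EuclideanSpace ℝ (Fin n), ‖(𝓕 φ : 𝓢(EuclideanSpace ℝ (Fin n), ℂ)) η‖) := by
      intro q
      simp only [norm_mul, norm_innerIntegral]
      rw [integral_const_mul, integral_affine N (fun η : EuclideanSpace ℝ (Fin n) => ‖(𝓕 φ : 𝓢(EuclideanSpace ℝ (Fin n), ℂ)) η‖), smul_eq_mul]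
    simp_rw [h6]
    exact hc.mul_right _
variable {d : Type*} [Fintype d]
def torusPt {d : Type*} (w : d → ℝ) : UnitAddTorus d := fun i => (w i : UnitAddCircle)

lemma isOpenQuotientMap_torusPt (d : Type*) [Fintype d] :
    IsOpenQuotientMap (torusPt : (d → ℝ) → UnitAddTorus d) :=
  IsOpenQuotientMap.piMap (fun _ => QuotientAddGroup.isOpenQuotientMap_mk)

lemma mFourier_torusPt (k : d → ℤ) (w : d → ℝ) : UnitAddTorus.mFourier k (torusPt w) =
    Complex.exp (2 * Real.pi * Complex.I * ∑ i, (k i : ℂ) * (w i : ℂ)) := by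
  have : UnitAddTorus.mFourier k (torusPt w) = ∏ i, fourier (k i) ((w i : ℝ) : UnitAddCircle) := rfl
  rw [this, Finset.mul_sum, Complex.exp_sum]
  refine Finset.prod_congr rfl fun i _ => ?_
  rw [fourier_coe_apply]; congr 1; simp; ring

structure PeriodicSmooth (G : (d → ℝ) → ℂ) : Prop where
  contDiff : ContDiff ℝ ∞ G
  periodic : ∀ (k : d → ℤ) (w : d → ℝ), G (w + fun i => (k i : ℝ)) = G w

lemma PeriodicSmooth.desc {G : (d → ℝ) → ℂ} (h : PeriodicSmooth G) :
    ∃ g : C(UnitAddTorus d, ℂ), ∀ w, g (torusPt w) = G w := by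
  have hq := isOpenQuotientMap_torusPt d
  have key : ∀ v w, torusPt v = torusPt w → G v = G w := by
    intro v w hvw
    have : ∀ i, ∃ m : ℤ, v i = w i + m := by
      intro i
      have h1 := congrFun hvw i
      obtain ⟨m, hm⟩ := QuotientAddGroup.eq_iff_sub_mem.1 h1
      exact ⟨m, by simp at hm; linarith⟩
    choose m hm using this
    rw [← h.periodic m w]
    congr 1
    funext i; exact hm i
  let s := Function.surjInv hq.surjective
  have hs : ∀ w, G (s (torusPt w)) = G w := fun w => key _ _ (Function.surjInv_eq hq.surjective _)
  refine ⟨⟨fun t => G (s t), ?_⟩, hs⟩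
  rw [hq.isQuotientMap.continuous_iff]
  exact h.contDiff.continuous.congr (fun w => (hs w).symm)

def partialDeriv [DecidableEq d] (i : d) (G : (d → ℝ) → ℂ) (w : d → ℝ) : ℂ := fderiv ℝ G w (Pi.single i 1)

lemma PeriodicSmooth.pderiv [DecidableEq d] {G : (d → ℝ) → ℂ} (h : PeriodicSmooth G) (i : d) : PeriodicSmooth (partialDeriv i G) where
  contDiff := (h.contDiff.fderiv_right (m := ∞) (by simp)).clm_apply contDiff_const
  periodic k w := by
    unfold partialDeriv
    have : G = fun w => G (w + fun i => (k i : ℝ)) := funext fun w => (h.periodic k w).symm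
    conv_rhs => rw [this]
    rw [fderiv_comp_add_right]

lemma coeff_def (g : UnitAddTorus d → ℂ) (k : d → ℤ) : UnitAddTorus.mFourierCoeff g k =
   ∫ t, UnitAddTorus.mFourier (-k) t • g t ∂(Measure.pi fun _ : d => AddCircle.haarAddCircle) := rfl

lemma coeff_partialDeriv [DecidableEq d] {G : (d → ℝ) → ℂ} (h : PeriodicSmooth G) (i : d) (g g' : C(UnitAddTorus d, ℂ))
    (hg : ∀ w, g (torusPt w) = G w) (hg' : ∀ w, g' (torusPt w) = partialDeriv i G w) (k : d → ℤ) :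
    UnitAddTorus.mFourierCoeff g' k = 2 * Real.pi * Complex.I * k i * UnitAddTorus.mFourierCoeff g k := by
  set μ : Measure (UnitAddTorus d) := (Measure.pi fun _ : d => AddCircle.haarAddCircle) with hμ
  have hpt : ∀ (w : d → ℝ) (s : ℝ), torusPt w + torusPt (Pi.single i s) = torusPt (w + s • Pi.single i 1) := by
    intro w s; funext j
    by_cases hj : j = i
    · subst hj; simp [torusPt]
    · simp [torusPt, hj]
  have hderiv : ∀ (t : UnitAddTorus d) (s : ℝ),
      HasDerivAt (fun s : ℝ => g (t + torusPt (Pi.single i s))) (g' (t + torusPt (Pi.single i s))) s := by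
    intro t s
    obtain ⟨w, rfl⟩ := (isOpenQuotientMap_torusPt d).surjective t
    simp only [hpt, hg, hg']
    have h1 : HasFDerivAt G (fderiv ℝ G (w + s • Pi.single i 1)) (w + s • Pi.single i 1) :=
      (h.contDiff.differentiable (by simp) _).hasFDerivAt
    have h2 : HasDerivAt (fun s : ℝ => w + s • (Pi.single i 1 : d → ℝ)) (Pi.single i 1) s := by
      simpa using ((hasDerivAt_id s).smul_const (Pi.single i 1 : d → ℝ)).const_add w
    exact h1.comp_hasDerivAt s h2
  have hprob : IsProbabilityMeasure μ := by rw [hμ]; infer_instance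
  have hinv : μ.IsAddHaarMeasure := by rw [hμ]; infer_instance
  have hcont : ∀ (u : C(UnitAddTorus d, ℂ)) (s : ℝ), Continuous fun t => UnitAddTorus.mFourier (-k) t • u (t + torusPt (Pi.single i s)) := by
    intro u s; fun_prop
  have hint : ∀ (u : C(UnitAddTorus d, ℂ)) (s : ℝ), Integrable (fun t => UnitAddTorus.mFourier (-k) t • u (t + torusPt (Pi.single i s))) μ :=
    fun u s => (hcont u s).integrable_of_hasCompactSupport (HasCompactSupport.of_compactSpace _)
  have hnorm : ∀ t, ‖UnitAddTorus.mFourier (-k) t‖ ≤ 1 := fun t =>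
    (ContinuousMap.norm_coe_le_norm _ t).trans_eq UnitAddTorus.mFourier_norm
  have main := (hasDerivAt_integral_of_dominated_loc_of_deriv_le (μ := μ) (𝕜 := ℝ) (x₀ := (0:ℝ)) (s := Set.univ)
    (F := fun s t => UnitAddTorus.mFourier (-k) t • g (t + torusPt (Pi.single i s)))
    (F' := fun s t => UnitAddTorus.mFourier (-k) t • g' (t + torusPt (Pi.single i s)))
    (bound := fun _ => ‖g'‖) Filter.univ_mem
    (Filter.Eventually.of_forall fun s => (hint g s).aestronglyMeasurable) (hint g 0)
    (hint g' 0).aestronglyMeasurable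
    (Filter.Eventually.of_forall fun t s _ => by
      rw [norm_smul]
      calc _ ≤ 1 * ‖g'‖ := mul_le_mul (hnorm t) (ContinuousMap.norm_coe_le_norm _ _) (norm_nonneg _) zero_le_one
        _ = _ := one_mul _)
    (integrable_const _)
    (Filter.Eventually.of_forall fun t s _ => (hderiv t s).const_smul (UnitAddTorus.mFourier (-k) t))).2
  have hz : torusPt (Pi.single i (0:ℝ)) = (0 : UnitAddTorus d) := by
    funext j; simp [torusPt]
  have hshift : ∀ s : ℝ, ∫ t, UnitAddTorus.mFourier (-k) t • g (t + torusPt (Pi.single i s)) ∂μ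
      = Complex.exp (2 * Real.pi * Complex.I * k i * s) * UnitAddTorus.mFourierCoeff g k := by
    intro s
    have h3 := integral_add_right_eq_self (μ := μ) (fun t => UnitAddTorus.mFourier (-k) (t - torusPt (Pi.single i s)) • g t) (torusPt (Pi.single i s))
    simp only [add_sub_cancel_right] at h3
    rw [h3, coeff_def, ← hμ, ← integral_const_mul]
    congr 1
    funext t
    have : UnitAddTorus.mFourier (-k) (t - torusPt (Pi.single i s)) = Complex.exp (2 * Real.pi * Complex.I * k i * s) * UnitAddTorus.mFourier (-k) t := by
      obtain ⟨w, rfl⟩ := (isOpenQuotientMap_torusPt d).surjective t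
      have e1 : torusPt w - torusPt (Pi.single i s) = torusPt (w - Pi.single i s) := rfl
      rw [e1, mFourier_torusPt, mFourier_torusPt, ← Complex.exp_add]
      congr 1
      have : ∑ j, (((-k) j : ℤ) : ℂ) * (((w - Pi.single i s : d → ℝ) j : ℝ) : ℂ)
          = k i * s + ∑ j, (((-k) j : ℤ) : ℂ) * ((w j : ℝ) : ℂ) := by
        have h6 : ∀ j, (((-k) j : ℤ) : ℂ) * (((w - Pi.single i s : d → ℝ) j : ℝ) : ℂ)
            = (if j = i then (k i * s : ℂ) else 0) + (((-k) j : ℤ) : ℂ) * ((w j : ℝ) : ℂ) := by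
          intro j
          by_cases hj : j = i
          · subst hj; simp; ring
          · simp [hj]
        simp_rw [h6]
        rw [Finset.sum_add_distrib]; simp
      rw [this]; ring
    rw [this]; simp [mul_assoc]
  simp only [hshift, hz, add_zero] at main
  have h4 : HasDerivAt (fun s : ℝ => Complex.exp (2 * Real.pi * Complex.I * k i * s) * UnitAddTorus.mFourierCoeff g k)
      (2 * Real.pi * Complex.I * k i * UnitAddTorus.mFourierCoeff g k) 0 := by
    have h5 : HasDerivAt (fun s : ℝ => Complex.exp (2 * Real.pi * Complex.I * k i * s)) (2 * Real.pi * Complex.I * k i) 0 := by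
      have := ((Complex.ofRealCLM.hasDerivAt (x := (0:ℝ))).const_mul (2 * Real.pi * Complex.I * k i : ℂ)).cexp
      simpa using this
    exact h5.mul_const _
  exact main.unique h4

lemma summable_int_norm (d : Type*) [Fintype d] :
    ∃ M : ℕ, M ≠ 0 ∧ Summable fun k : d → ℤ => (‖(fun i => (k i : ℝ) : d → ℝ)‖⁻¹) ^ M := by
  classical
  let L := Submodule.span ℤ (Set.range (Pi.basisFun ℝ d))
  refine ⟨Module.finrank ℤ L + 1, by simp, ?_⟩
  have hs := ZLattice.summable_norm_pow_inv L (Module.finrank ℤ L + 1) (Nat.lt_succ_self _)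
  have hmem : ∀ k : d → ℤ, (fun i => (k i : ℝ) : d → ℝ) ∈ L := by
    intro k
    rw [Module.Basis.mem_span_iff_repr_mem]
    intro i; simp
  let e : (d → ℤ) → L := fun k => ⟨_, hmem k⟩
  have he : Function.Injective e := by
    intro k l h
    have := congrArg Subtype.val h
    funext i
    have h2 : (k i : ℝ) = l i := congrFun this i
    exact_mod_cast h2
  have h3 := hs.comp_injective he
  exact h3

lemma PeriodicSmooth.iter [DecidableEq d] {G : (d → ℝ) → ℂ} (h : PeriodicSmooth G) (i : d) (g : C(UnitAddTorus d, ℂ))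
    (hg : ∀ w, g (torusPt w) = G w) (M : ℕ) :
    ∃ B : ℝ, ∀ k : d → ℤ, ‖(k i : ℝ)‖ ^ M * ‖UnitAddTorus.mFourierCoeff g k‖ ≤ B := by
  induction M generalizing G g with
  | zero =>
    refine ⟨‖g‖, fun k => ?_⟩
    rw [pow_zero, one_mul, coeff_def]
    refine (norm_integral_le_of_norm_le_const (C := ‖g‖) (Filter.Eventually.of_forall fun t => ?_)).trans ?_
    · rw [norm_smul]
      have hn : ‖UnitAddTorus.mFourier (-k) t‖ ≤ 1 :=
        (ContinuousMap.norm_coe_le_norm _ t).trans_eq UnitAddTorus.mFourier_norm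
      calc _ ≤ 1 * ‖g‖ := mul_le_mul hn (ContinuousMap.norm_coe_le_norm _ _) (norm_nonneg _) zero_le_one
        _ = _ := one_mul _
    · simp
  | succ M ih =>
    obtain ⟨g', hg'⟩ := (h.pderiv i).desc
    obtain ⟨B, hB⟩ := ih (h.pderiv i) g' hg'
    refine ⟨B, fun k => le_trans ?_ (hB k)⟩
    rw [coeff_partialDeriv h i g g' hg hg', pow_succ, mul_assoc]
    gcongr
    simp only [norm_mul, Complex.norm_I, Complex.norm_real, Complex.norm_ofNat, mul_one]
    have e : ‖((k i : ℤ) : ℂ)‖ = ‖((k i : ℤ) : ℝ)‖ := by simp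
    rw [e]
    gcongr
    have : (1:ℝ) ≤ 2 * ‖Real.pi‖ := by
      rw [Real.norm_of_nonneg Real.pi_pos.le]; linarith [Real.pi_gt_three]
    nlinarith [norm_nonneg ((k i : ℤ) : ℝ)]

lemma PeriodicSmooth.summable {G : (d → ℝ) → ℂ} (h : PeriodicSmooth G) (g : C(UnitAddTorus d, ℂ))
    (hg : ∀ w, g (torusPt w) = G w) : Summable (UnitAddTorus.mFourierCoeff g) := by
  classical
  obtain ⟨M, hM, hs⟩ := summable_int_norm d
  choose B hB using fun i => h.iter i g hg M
  have hB0 : ∀ i, 0 ≤ B i := fun i => le_trans (by positivity) (hB i 0)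
  refine Summable.of_norm_bounded_eventually (hs.mul_left (∑ i, B i)) ?_
  rw [Filter.eventually_cofinite]
  refine (Set.finite_singleton (0 : d → ℤ)).subset fun k hk => ?_
  by_contra hk0
  apply hk
  have hk0 : k ≠ 0 := hk0
  have hne : (fun i => (k i : ℝ) : d → ℝ) ≠ 0 := by
    intro h0; apply hk0; funext i; have h2 : (k i : ℝ) = 0 := congrFun h0 i
    exact_mod_cast h2
  obtain ⟨j, hj⟩ := Function.ne_iff.1 hk0
  have : Nonempty d := ⟨j⟩
  obtain ⟨i, hi⟩ := Finite.exists_max (fun i => ‖(k i : ℝ)‖)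
  have hpos : 0 < ‖(fun i => (k i : ℝ) : d → ℝ)‖ := norm_pos_iff.2 hne
  rw [inv_pow, ← div_eq_mul_inv, le_div_iff₀ (by positivity), mul_comm]
  have hi' : ‖(fun i => (k i : ℝ) : d → ℝ)‖ ≤ ‖(k i : ℝ)‖ :=
    (pi_norm_le_iff_of_nonneg (norm_nonneg _)).2 hi
  refine (mul_le_mul_of_nonneg_right (pow_le_pow_left₀ hpos.le hi' M) (norm_nonneg _)).trans ?_
  exact (hB i k).trans (Finset.single_le_sum (fun i _ => hB0 i) (Finset.mem_univ i))

lemma PeriodicSmooth.fourier {G : (d → ℝ) → ℂ} (h : PeriodicSmooth G) : ∃ c : (d → ℤ) → ℂ, Summable (fun k => ‖c k‖) ∧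
    ∀ w, HasSum (fun k => c k * Complex.exp (2 * Real.pi * Complex.I * ∑ i, (k i : ℂ) * (w i : ℂ))) (G w) := by
  obtain ⟨g, hg⟩ := h.desc
  refine ⟨UnitAddTorus.mFourierCoeff g, (h.summable g hg).norm, fun w => ?_⟩
  have := UnitAddTorus.hasSum_mFourier_series_apply_of_summable (h.summable g hg) (torusPt w)
  simpa only [mFourier_torusPt, hg, smul_eq_mul] using this

lemma inner_intVec (l : Fin n → ℤ) (x : EuclideanSpace ℝ (Fin n)) : ⟪intVec l, x⟫ = ∑ i, (l i : ℝ) * x i := by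
  simp [intVec, PiLp.inner_apply, mul_comm]

/-- The Fourier expansion of a smooth function on the torus converges absolutely. -/
lemma IsSmoothOnTorus.fourier {f : EuclideanSpace ℝ (Fin n) × EuclideanSpace ℝ (Fin n) → ℂ} (hf : IsSmoothOnTorus f) :
    ∃ c : (Fin n ⊕ Fin n → ℤ) → ℂ, Summable (fun q => ‖c q‖) ∧ ∀ x ξ,
      HasSum (fun q => c q * exp2pi (⟪intVec (fun i => q (Sum.inl i)), x⟫ + ⟪intVec (fun i => q (Sum.inr i)), ξ⟫)) (f (x, ξ)) := by
  let G : (Fin n ⊕ Fin n → ℝ) → ℂ := fun w =>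
    f (WithLp.toLp 2 (fun i => w (Sum.inl i)), WithLp.toLp 2 (fun i => w (Sum.inr i)))
  have hG : PeriodicSmooth G := by
    refine ⟨?_, ?_⟩
    · refine hf.contDiff.comp (ContDiff.prodMk ?_ ?_)
      · exact (PiLp.contDiff_toLp).comp (contDiff_pi.2 fun i => contDiff_apply ℝ ℝ _)
      · exact (PiLp.contDiff_toLp).comp (contDiff_pi.2 fun i => contDiff_apply ℝ ℝ _)
    · intro k w
      exact hf.periodic (fun i => k (Sum.inl i)) (fun i => k (Sum.inr i))
        (WithLp.toLp 2 (fun i => w (Sum.inl i))) (WithLp.toLp 2 (fun i => w (Sum.inr i)))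
  obtain ⟨c, hc, hs⟩ := hG.fourier
  refine ⟨c, hc, fun x ξ => ?_⟩
  have := hs (Sum.elim x ξ)
  simp only [G, Sum.elim_inl, Sum.elim_inr] at this
  convert this using 3 with q
  rw [exp2pi, inner_intVec, inner_intVec]
  congr 1
  rw [Fintype.sum_sum_type]
  push_cast
  simp only [Sum.elim_inl, Sum.elim_inr]
  ring

def gridPt (N : ℕ) (k : Fin n → ℤ) : EuclideanSpace ℝ (Fin n) := WithLp.toLp 2 (fun i => (k i : ℝ) / N)

lemma summable_gridPt (N : ℕ) [NeZero N] (φ : 𝓢(EuclideanSpace ℝ (Fin n), ℂ)) : Summable fun k : Fin n → ℤ => ‖φ (gridPt N k)‖ := by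
  obtain ⟨M, hM, hs⟩ := summable_int_norm (Fin n)
  have hN : (0 : ℝ) < N := by exact_mod_cast Nat.pos_of_ne_zero (NeZero.ne N)
  obtain ⟨C, hC0, hC⟩ := φ.decay M 0
  refine Summable.of_norm_bounded_eventually (hs.mul_left ((N : ℝ) ^ M * C)) ?_
  rw [Filter.eventually_cofinite]
  refine (Set.finite_singleton (0 : Fin n → ℤ)).subset fun k hk => ?_
  by_contra hk0
  apply hk
  have hk0 : k ≠ 0 := hk0
  have hne : (fun i => (k i : ℝ) : Fin n → ℝ) ≠ 0 := by
    intro h0; apply hk0; funext i; have h2 : (k i : ℝ) = 0 := congrFun h0 i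
    exact_mod_cast h2
  have hpos : 0 < ‖(fun i => (k i : ℝ) : Fin n → ℝ)‖ := norm_pos_iff.2 hne
  rw [inv_pow, ← div_eq_mul_inv, le_div_iff₀ (by positivity), mul_comm, norm_norm]
  have h1 : ‖(fun i => (k i : ℝ) : Fin n → ℝ)‖ ≤ N * ‖(gridPt N k : EuclideanSpace ℝ (Fin n))‖ := by
    rw [pi_norm_le_iff_of_nonneg (by positivity)]
    intro i
    have := PiLp.norm_apply_le (gridPt N k) i
    simp only [gridPt, norm_div] at this
    rw [div_le_iff₀ (by simpa using hN)] at this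
    simpa [gridPt, mul_comm] using this
  have h2 := hC (gridPt N k)
  rw [norm_iteratedFDeriv_zero] at h2
  calc _ ≤ (N * ‖(gridPt N k : EuclideanSpace ℝ (Fin n))‖) ^ M * ‖φ (gridPt N k)‖ := by gcongr
    _ = N ^ M * (‖(gridPt N k : EuclideanSpace ℝ (Fin n))‖ ^ M * ‖φ (gridPt N k)‖) := by ring
    _ ≤ _ := by gcongr

/-- The factor `exp(πi(2⟨j, l⟩ - ⟨l, m⟩)/N)`. -/
def weylPhase (N : ℕ) (j : Fin n → ZMod N) (l m : Fin n → ℤ) : ℂ :=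
  exp2pi ((∑ i, (l i : ℝ) * ((j i).val : ℝ)) / N - (∑ i, (l i : ℝ) * (m i : ℝ)) / (2 * N))

lemma weylPhase_eq (N : ℕ) [NeZero N] (j : Fin n → ZMod N) (l m k : Fin n → ℤ) (hk : ∀ i, (k i : ZMod N) = j i) :
    exp2pi (⟪intVec l, gridPt N k⟫ - ⟪intVec l, (N : ℝ)⁻¹ • intVec m⟫ / 2) = weylPhase N j l m := by
  have hN : (N : ℝ) ≠ 0 := by exact_mod_cast NeZero.ne N
  have : ∀ i, ∃ r : ℤ, k i = (j i).val + N * r := by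
    intro i
    have h1 : ((k i - ((j i).val : ℤ) : ℤ) : ZMod N) = 0 := by
      push_cast; rw [hk i, ZMod.natCast_zmod_val, sub_self]
    obtain ⟨r, hr⟩ := (ZMod.intCast_zmod_eq_zero_iff_dvd _ N).1 h1
    exact ⟨r, by linarith⟩
  choose r hr using this
  have e : ⟪intVec l, (gridPt N k : EuclideanSpace ℝ (Fin n))⟫ - ⟪intVec l, (N : ℝ)⁻¹ • intVec m⟫ / 2 =
     ((∑ i, l i * r i : ℤ) : ℝ) + ((∑ i, (l i : ℝ) * ((j i).val : ℝ)) / N - (∑ i, (l i : ℝ) * (m i : ℝ)) / (2 * N)) := by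
    rw [inner_intVec, inner_intVec]
    have a1 : ∑ i, (l i : ℝ) * (gridPt N k : EuclideanSpace ℝ (Fin n)) i = ((∑ i, l i * r i : ℤ) : ℝ) + (∑ i, (l i : ℝ) * ((j i).val : ℝ)) / N := by
      push_cast
      rw [Finset.sum_div, ← Finset.sum_add_distrib]
      refine Finset.sum_congr rfl fun i _ => ?_
      simp only [gridPt]
      rw [hr i]; push_cast; field_simp; ring
    have a2 : ∑ i, (l i : ℝ) * ((N : ℝ)⁻¹ • intVec m : EuclideanSpace ℝ (Fin n)) i = (∑ i, (l i : ℝ) * (m i : ℝ)) / N := by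
      rw [Finset.sum_div]
      refine Finset.sum_congr rfl fun i _ => ?_
      simp [intVec]; ring
    rw [a1, a2]; field_simp; ring
  rw [e, exp2pi_add, exp2pi_int, one_mul, weylPhase]

def shiftEquiv (N : ℕ) (j : Fin n → ZMod N) (m : Fin n → ℤ) :
    {k : Fin n → ℤ // ∀ i, (k i : ZMod N) = j i} ≃ {k : Fin n → ℤ // ∀ i, (k i : ZMod N) = j i - m i} where
  toFun k := ⟨k.1 - m, fun i => by simp [k.2 i]⟩
  invFun k := ⟨k.1 + m, fun i => by simp [k.2 i]⟩
  left_inv k := by simp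
  right_inv k := by simp

lemma gridPt_sub (N : ℕ) (k m : Fin n → ℤ) : gridPt N (k - m) = gridPt N k - (N : ℝ)⁻¹ • intVec m := by
  ext i; simp [gridPt, intVec]; ring

theorem isQuantizationMatrix_of_hasSum (N : ℕ) [NeZero N] (f : EuclideanSpace ℝ (Fin n) × EuclideanSpace ℝ (Fin n) → ℂ)
    (c : (Fin n ⊕ Fin n → ℤ) → ℂ) (hc : Summable fun q => ‖c q‖)
    (hf : ∀ x ξ, HasSum (fun q => c q * exp2pi (⟪intVec (fun i => q (Sum.inl i)), x⟫ + ⟪intVec (fun i => q (Sum.inr i)), ξ⟫)) (f (x, ξ))) :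
    IsQuantizationMatrix f N (fun p j => ∑' q : Fin n ⊕ Fin n → ℤ,
      if (∀ i, p i = j i - (q (Sum.inr i) : ZMod N)) then
        c q * weylPhase N j (fun i => q (Sum.inl i)) (fun i => q (Sum.inr i)) else 0) := by
  classical
  intro j φ
  have hsum := summable_gridPt N φ
  set S : (Fin n → ZMod N) → ℂ := fun p => ∑' k : {k : Fin n → ℤ // ∀ i, (k i : ZMod N) = p i}, φ (gridPt N k.1) with hS
  have hcomb : ∀ p, comb N p φ = ((Real.sqrt ((N : ℝ) ^ n))⁻¹ : ℝ) * S p := fun p => rfl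
  let T : (Fin n ⊕ Fin n → ℤ) → {k : Fin n → ℤ // ∀ i, (k i : ZMod N) = j i} → ℂ := fun q k =>
    c q * weylPhase N j (fun i => q (Sum.inl i)) (fun i => q (Sum.inr i)) * φ (gridPt N (k.1 - fun i => q (Sum.inr i)))
  have hW : ∀ k : {k : Fin n → ℤ // ∀ i, (k i : ZMod N) = j i},
      weylTranspose (1 / (2 * Real.pi * N)) f φ (gridPt N k.1) = ∑' q, T q k := by
    intro k
    rw [weylTranspose_hasSum N f c _ _ hc hf]
    congr 1; funext q
    rw [weylPhase_eq N j _ _ k.1 k.2, ← gridPt_sub, ← mul_assoc]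
  have hnph : ∀ l m, ‖weylPhase N j l m‖ = 1 := fun l m => norm_exp2pi _
  have hTn : ∀ q k, ‖T q k‖ = ‖c q‖ * ‖φ (gridPt N (k.1 - fun i => q (Sum.inr i)))‖ := by
    intro q k; simp only [T, norm_mul, hnph, mul_one]
  have hinj : ∀ m : Fin n → ℤ, Function.Injective
      (fun k : {k : Fin n → ℤ // ∀ i, (k i : ZMod N) = j i} => k.1 - m) :=
    fun m a b h => Subtype.ext (sub_left_injective h)
  have hsm : ∀ m : Fin n → ℤ, Summable
      (fun k : {k : Fin n → ℤ // ∀ i, (k i : ZMod N) = j i} => ‖φ (gridPt N (k.1 - m))‖) :=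
    fun m => hsum.comp_injective (hinj m)
  have hT : Summable (Function.uncurry T) := by
    apply Summable.of_norm
    rw [summable_prod_of_nonneg (fun _ => norm_nonneg _)]
    refine ⟨fun q => ?_, ?_⟩
    · simp only [Function.uncurry, hTn]; exact (hsm _).mul_left _
    · simp only [Function.uncurry, hTn, tsum_mul_left]
      refine Summable.of_nonneg_of_le (fun q => by positivity) (fun q => ?_) (hc.mul_right (∑' k : Fin n → ℤ, ‖φ (gridPt N k)‖))
      gcongr
      exact (hsm _).tsum_le_tsum_of_inj _ (hinj _) (fun _ _ => norm_nonneg _) (fun _ => le_rfl) hsum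
  have hTk : ∀ q, ∑' k, T q k = c q * weylPhase N j (fun i => q (Sum.inl i)) (fun i => q (Sum.inr i)) *
      S (fun i => j i - (q (Sum.inr i) : ZMod N)) := by
    intro q
    simp only [T]
    rw [tsum_mul_left]
    congr 1
    rw [hS]
    exact (shiftEquiv N j (fun i => q (Sum.inr i))).tsum_eq
      (fun k : {k : Fin n → ℤ // ∀ i, (k i : ZMod N) = j i - ((q (Sum.inr i) : ℤ) : ZMod N)} => φ (gridPt N k.1))
  have hmain : ∑' k : {k : Fin n → ℤ // ∀ i, (k i : ZMod N) = j i},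
      weylTranspose (1 / (2 * Real.pi * N)) f φ (gridPt N k.1) =
      ∑ p, (∑' q : Fin n ⊕ Fin n → ℤ, if (∀ i, p i = j i - (q (Sum.inr i) : ZMod N)) then
        c q * weylPhase N j (fun i => q (Sum.inl i)) (fun i => q (Sum.inr i)) else 0) * S p := by
    simp_rw [hW]
    rw [hT.tsum_comm]
    simp_rw [hTk, ← tsum_mul_right]
    rw [← Summable.tsum_finsetSum]
    · congr 1; funext q
      rw [Finset.sum_eq_single (fun i => j i - (q (Sum.inr i) : ZMod N))]
      · simp
      · intro p _ hp
        rw [if_neg (fun h => hp (funext h)), zero_mul]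
      · simp
    · intro p _
      refine Summable.mul_right _ (Summable.of_norm_bounded hc fun q => ?_)
      split_ifs
      · rw [norm_mul, hnph, mul_one]
      · simp
  calc comb N j (weylTranspose (1 / (2 * Real.pi * N)) f φ)
      = ((Real.sqrt ((N : ℝ) ^ n))⁻¹ : ℝ) * ∑' k : {k : Fin n → ℤ // ∀ i, (k i : ZMod N) = j i},
      weylTranspose (1 / (2 * Real.pi * N)) f φ (gridPt N k.1) := rfl
    _ = _ := by
      rw [hmain, Finset.mul_sum]
      refine Finset.sum_congr rfl fun p _ => ?_
      rw [hcomb]; ring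

theorem exists_test_function (N : ℕ) [NeZero N] (p : Fin n → ZMod N) : ∃ φ : 𝓢(EuclideanSpace ℝ (Fin n), ℂ),
    comb N p φ ≠ 0 ∧ ∀ m, m ≠ p → comb N m φ = 0 := by
  have hN : (0 : ℝ) < N := by exact_mod_cast Nat.pos_of_ne_zero (NeZero.ne N)
  let k₀ : Fin n → ℤ := fun i => (p i).val
  have hk₀ : ∀ i, (k₀ i : ZMod N) = p i := fun i => by simp [k₀]
  let b : ContDiffBump (gridPt N k₀ : EuclideanSpace ℝ (Fin n)) := ⟨1 / (4 * N), 1 / (2 * N), by positivity, by gcongr; norm_num⟩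
  have hsupp : HasCompactSupport (fun x => ((b x : ℝ) : ℂ)) :=
    b.hasCompactSupport.comp_left (g := fun t : ℝ => (t : ℂ)) (by simp)
  have hsmooth : ContDiff ℝ ∞ (fun x => ((b x : ℝ) : ℂ)) := Complex.ofRealCLM.contDiff.comp b.contDiff
  have hzero : ∀ k : Fin n → ℤ, k ≠ k₀ → b (gridPt N k) = 0 := by
    intro k hk
    apply b.zero_of_le_dist
    obtain ⟨i, hi⟩ := Function.ne_iff.1 hk
    have h1 := PiLp.norm_apply_le (gridPt N k - gridPt N k₀ : EuclideanSpace ℝ (Fin n)) i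
    rw [dist_eq_norm]
    refine le_trans ?_ h1
    have h2 : (gridPt N k - gridPt N k₀ : EuclideanSpace ℝ (Fin n)) i = ((k i - k₀ i : ℤ) : ℝ) / N := by
      simp [gridPt]; ring
    rw [h2, norm_div, Real.norm_of_nonneg hN.le]
    have h3 : (1 : ℝ) ≤ ‖((k i - k₀ i : ℤ) : ℝ)‖ := by
      rw [Real.norm_eq_abs, ← Int.cast_abs]
      exact_mod_cast Int.one_le_abs (sub_ne_zero.2 hi)
    show 1 / (2 * (N : ℝ)) ≤ _
    rw [div_le_div_iff₀ (by positivity) hN]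
    nlinarith
  refine ⟨hsupp.toSchwartzMap hsmooth, ?_, ?_⟩
  · have : comb N p (hsupp.toSchwartzMap hsmooth) = ((Real.sqrt ((N : ℝ) ^ n))⁻¹ : ℝ) *
        ∑' k : {k : Fin n → ℤ // ∀ i, (k i : ZMod N) = p i}, ((b (gridPt N k.1) : ℝ) : ℂ) := rfl
    rw [this, tsum_eq_single ⟨k₀, hk₀⟩]
    · rw [b.one_of_mem_closedBall (Metric.mem_closedBall_self b.rIn_pos.le)]
      have : Real.sqrt ((N : ℝ) ^ n) ≠ 0 := (Real.sqrt_pos.2 (by positivity)).ne'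
      simpa using this
    · intro k hk
      rw [hzero k.1 (fun h => hk (Subtype.ext h))]; simp
  · intro m hm
    have : comb N m (hsupp.toSchwartzMap hsmooth) = ((Real.sqrt ((N : ℝ) ^ n))⁻¹ : ℝ) *
        ∑' k : {k : Fin n → ℤ // ∀ i, (k i : ZMod N) = m i}, ((b (gridPt N k.1) : ℝ) : ℂ) := rfl
    rw [this]
    have hz : ∀ k : {k : Fin n → ℤ // ∀ i, (k i : ZMod N) = m i}, ((b (gridPt N k.1) : ℝ) : ℂ) = 0 := by
      intro k
      rw [hzero k.1 (fun h => hm (funext fun i => by rw [← k.2 i, h, hk₀ i]))]; simp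
    simp [hz]

theorem IsQuantizationMatrix.unique {N : ℕ} [NeZero N] {f : EuclideanSpace ℝ (Fin n) × EuclideanSpace ℝ (Fin n) → ℂ}
    {F F' : Matrix (Fin n → ZMod N) (Fin n → ZMod N) ℂ}
    (h : IsQuantizationMatrix f N F) (h' : IsQuantizationMatrix f N F') : F = F' := by
  ext p j
  obtain ⟨φ, h1, h2⟩ := exists_test_function N p
  have h3 := (h j φ).symm.trans (h' j φ)
  rw [Finset.sum_eq_single p (fun m _ hm => by rw [h2 m hm, mul_zero]) (by simp),
    Finset.sum_eq_single p (fun m _ hm => by rw [h2 m hm, mul_zero]) (by simp)] at h3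
  exact mul_right_cancel₀ h1 h3

theorem existsUnique_isQuantizationMatrix {f : EuclideanSpace ℝ (Fin n) × EuclideanSpace ℝ (Fin n) → ℂ} (hf : IsSmoothOnTorus f)
    (N : ℕ) [NeZero N] : ∃! F, IsQuantizationMatrix f N F := by
  obtain ⟨c, hc, hs⟩ := hf.fourier
  exact ⟨_, isQuantizationMatrix_of_hasSum N f c hc hs, fun _ h => h.unique (isQuantizationMatrix_of_hasSum N f c hc hs)⟩

theorem quantize_spec {f : EuclideanSpace ℝ (Fin n) × EuclideanSpace ℝ (Fin n) → ℂ} (hf : IsSmoothOnTorus f)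
    (N : ℕ) [NeZero N] : IsQuantizationMatrix f N (quantize f N) := by
  have h := (existsUnique_isQuantizationMatrix hf N).exists
  rw [quantize, dif_pos h]
  exact h.choose_spec

/-- The explicit form of the matrix `f_N` in terms of the Fourier coefficients of `f`. -/
theorem quantize_eq_of_hasSum (N : ℕ) [NeZero N]
    (f : EuclideanSpace ℝ (Fin n) × EuclideanSpace ℝ (Fin n) → ℂ)
    (c : (Fin n ⊕ Fin n → ℤ) → ℂ) (hc : Summable fun q => ‖c q‖)
    (hf : ∀ x ξ, HasSum (fun q => c q * exp2pi (⟪intVec (fun i => q (Sum.inl i)), x⟫ +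
      ⟪intVec (fun i => q (Sum.inr i)), ξ⟫)) (f (x, ξ))) :
    quantize f N = fun p j => ∑' q : Fin n ⊕ Fin n → ℤ,
      if (∀ i, p i = j i - (q (Sum.inr i) : ZMod N)) then
        c q * weylPhase N j (fun i => q (Sum.inl i)) (fun i => q (Sum.inr i)) else 0 := by
  have h0 := isQuantizationMatrix_of_hasSum N f c hc hf
  have h : ∃ F, IsQuantizationMatrix f N F := ⟨_, h0⟩
  rw [quantize, dif_pos h]
  exact h.choose_spec.unique h0

end WellDefined

end TorusQuantization

end

noncomputable section

namespace TorusQuantization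

/-! The rank of `ψ(f_N f_N^*/α²)` is at most the number of eigenvalues of `f_N f_N^*/α²` in `K`, and
each corresponding unit eigenvector `v` satisfies `‖f_N^* v‖² ≤ R α²` with `R` an upper bound for
`K`. The task is to bound the size of an orthonormal family with this property, and no symbol
calculus or functional calculus beyond diagonalization is needed for it.

The comparison object is the coherent state (anti-Wick) quantization of `|f|²` on the phase space
grid `(ℤ/N)²ⁿ`: the quadratic form averaging `|f|²` against `‖coherent Φ x ξ v‖²`. Expand `f` in its
Fourier series. Each exponential is quantized by `f_N` to a phase space translation. In `f_N f_N^*`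
the product of the translation of frequency `q` with the adjoint of that of frequency `r` is the
translation of frequency `q - r` times a phase `exp(πiσ(q,r)/N)`. In the coherent average the same
translation appears times its expectation in the state `Φ`. Both factors are `1 + O(1/N)` with
polynomial loss in the frequencies, which the rapid decay of the Fourier coefficients absorbs. This
gives `IsSmoothOnTorus.exists_coherent_comparison`. The expectation is `1 + O(1/N)`, and not merely
`1 + O(N^{-1/2})`, because an even real state makes it real (`weylExpect_conj`), so that the phases
enter only through `1 - cos` (`norm_one_sub_weylExpect_le`).

Since `ρ < 1/2` gives `1/N ≤ α²`, the error is of the size of the energy `R α²`. The resolution of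
identity, Bessel's inequality and a Chebyshev argument (`card_le_of_coherent_comparison`) then bound
`N^n` times the number of eigenvectors by twice the number of grid points where `|f| ≤ const · α`.
As `f` is Lipschitz, the cells of volume `N^{-2n}` at these points lie in a sublevel set of
comparable height (`card_sublevel_le_volume`), and the volume hypothesis finishes the proof. -/

/-! ### A localized vector on `ℤ/N` -/

/-- The tent function on `ℤ/N` of width `√N`. -/
def tent (N : ℕ) (y : ZMod N) : ℝ := max 0 ((N.sqrt : ℝ) - (y.valMinAbs.natAbs : ℝ))

lemma tent_neg (N : ℕ) (y : ZMod N) : tent N (-y) = tent N y := by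
  simp [tent, ZMod.natAbs_valMinAbs_neg]

lemma natAbs_valMinAbs_lt_of_tent_ne_zero {N : ℕ} {y : ZMod N} (h : tent N y ≠ 0) :
    y.valMinAbs.natAbs < N.sqrt := by
  by_contra hle
  apply h
  have : (N.sqrt : ℝ) ≤ y.valMinAbs.natAbs := by exact_mod_cast not_lt.1 hle
  exact max_eq_left (by linarith)

lemma natAbs_valMinAbs_intCast_le (N : ℕ) [NeZero N] (m : ℤ) :
    (m : ZMod N).valMinAbs.natAbs ≤ m.natAbs := by
  refine ZMod.natAbs_min_of_le_div_two N _ _ ?_ (ZMod.natAbs_valMinAbs_le _)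
  rw [ZMod.coe_valMinAbs]

/-- The distance to `0` on the cycle `ℤ/N` obeys the triangle inequality, and truncation at `0` is a
contraction. -/
lemma abs_tent_sub_le (N : ℕ) [NeZero N] (y : ZMod N) (m : ℤ) :
    |tent N y - tent N (y - m)| ≤ |(m : ℝ)| := by
  have key : ∀ (a b : ZMod N), (a + b).valMinAbs.natAbs ≤ a.valMinAbs.natAbs + b.valMinAbs.natAbs :=
    fun a b => (ZMod.natAbs_valMinAbs_add_le a b).trans (Int.natAbs_add_le _ _)
  have h1 := key (y - m) m
  have h2 := key y (-m)
  rw [ZMod.natAbs_valMinAbs_neg, ← sub_eq_add_neg] at h2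
  rw [sub_add_cancel] at h1
  have h3 := natAbs_valMinAbs_intCast_le N m
  have h4 : |(m : ℝ)| = (m.natAbs : ℝ) := by rw [Nat.cast_natAbs, Int.cast_abs]
  have h1' : (y.valMinAbs.natAbs : ℝ) ≤ (y - m).valMinAbs.natAbs + m.natAbs := by
    exact_mod_cast h1.trans (by gcongr)
  have h2' : ((y - m).valMinAbs.natAbs : ℝ) ≤ y.valMinAbs.natAbs + m.natAbs := by
    exact_mod_cast h2.trans (by gcongr)
  rw [h4]
  unfold tent
  rw [max_comm, max_comm 0]
  refine (abs_max_sub_max_le_abs _ _ _).trans ?_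
  rw [abs_le]
  constructor <;> linarith

lemma card_tent_ne_zero_le (N : ℕ) [NeZero N] :
    (Finset.univ.filter fun y : ZMod N => tent N y ≠ 0).card ≤ 2 * N.sqrt := by
  have h : (Finset.univ.filter fun y : ZMod N => tent N y ≠ 0).card ≤
      (Finset.Ioo (-(N.sqrt : ℤ)) N.sqrt).card := by
    refine Finset.card_le_card_of_injOn ZMod.valMinAbs (fun y hy => ?_)
      (ZMod.injective_valMinAbs.injOn)
    have := natAbs_valMinAbs_lt_of_tent_ne_zero (Finset.mem_filter.1 hy).2
    simp only [Finset.coe_Ioo, Set.mem_Ioo]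
    omega
  refine h.trans ?_
  rw [Int.card_Ioo]
  omega

/-- A term vanishes unless `y` or `y - m` lies in the support, which has at most `2√N` points, and
by the Lipschitz bound each term is at most `m²`. -/
lemma sum_sq_tent_sub_le (N : ℕ) [NeZero N] (m : ℤ) :
    ∑ y : ZMod N, (tent N y - tent N (y - m)) ^ 2 ≤ 4 * N.sqrt * (m : ℝ) ^ 2 := by
  have hpt : ∀ y : ZMod N, (tent N y - tent N (y - m)) ^ 2 ≤
      (if tent N y ≠ 0 then (m : ℝ) ^ 2 else 0) + (if tent N (y - m) ≠ 0 then (m : ℝ) ^ 2 else 0) := by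
    intro y
    have h := sq_le_sq' (abs_le.1 (abs_tent_sub_le N y m)).1 (abs_le.1 (abs_tent_sub_le N y m)).2
    rw [sq_abs] at h
    split_ifs with h1 h2 h2
    · nlinarith [sq_nonneg (m : ℝ)]
    · linarith
    · linarith
    · rw [not_not] at h1 h2; rw [h1, h2]; simp
  refine (Finset.sum_le_sum fun y _ => hpt y).trans ?_
  have hshift := Equiv.sum_comp (Equiv.subRight (m : ZMod N))
    (fun y => if tent N y ≠ 0 then (m : ℝ) ^ 2 else 0)
  simp only [Equiv.subRight_apply] at hshift
  rw [Finset.sum_add_distrib, hshift, ← Finset.sum_filter, Finset.sum_const, nsmul_eq_mul]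
  have : ((Finset.univ.filter fun y : ZMod N => tent N y ≠ 0).card : ℝ) ≤ 2 * N.sqrt := by
    exact_mod_cast card_tent_ne_zero_le N
  nlinarith [sq_nonneg (m : ℝ)]

/-- With `s = N.sqrt`, the residues `0, …, s/2` are distinct, number at least `s/2`, and carry
height at least `s/2` each. -/
lemma le_sum_sq_tent (N : ℕ) [NeZero N] : (N.sqrt : ℝ) ^ 3 / 8 ≤ ∑ y : ZMod N, tent N y ^ 2 := by
  set s := N.sqrt with hs
  have hsN : s ≤ N := Nat.sqrt_le_self N
  have hNpos : 0 < N := Nat.pos_of_ne_zero (NeZero.ne N)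
  have hinj : Set.InjOn (fun y : ℕ => (y : ZMod N)) (Finset.range (s / 2 + 1)) := by
    intro a ha b hb hab
    simp only [Finset.coe_range, Set.mem_Iio] at ha hb
    have h := congrArg ZMod.valMinAbs hab
    simp only at h
    rw [ZMod.valMinAbs_natCast_of_le_half (by omega), ZMod.valMinAbs_natCast_of_le_half (by omega)] at h
    exact_mod_cast h
  have h1 : ∑ y ∈ (Finset.range (s / 2 + 1)).image (fun y : ℕ => (y : ZMod N)), tent N y ^ 2
      ≤ ∑ y : ZMod N, tent N y ^ 2 :=
    Finset.sum_le_sum_of_subset_of_nonneg (Finset.subset_univ _) fun _ _ _ => sq_nonneg _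
  rw [Finset.sum_image hinj] at h1
  refine le_trans ?_ h1
  have h2 : ∀ y ∈ Finset.range (s / 2 + 1), ((s : ℝ) / 2) ^ 2 ≤ tent N (y : ZMod N) ^ 2 := by
    intro y hy
    rw [Finset.mem_range] at hy
    have hy2 : (y : ℝ) ≤ s / 2 := by
      rw [le_div_iff₀ two_pos]; exact_mod_cast (by omega : y * 2 ≤ s)
    refine pow_le_pow_left₀ (by positivity) ?_ 2
    rw [tent, ZMod.valMinAbs_natCast_of_le_half (by omega), Int.natAbs_natCast]
    exact le_max_of_le_right (by rw [← hs]; linarith)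
  refine le_trans ?_ (Finset.card_nsmul_le_sum _ _ _ h2)
  rw [Finset.card_range, nsmul_eq_mul]
  have h3 : (s : ℝ) / 2 ≤ ((s / 2 + 1 : ℕ) : ℝ) := by
    rw [div_le_iff₀ two_pos]; exact_mod_cast (by omega : s ≤ (s / 2 + 1) * 2)
  nlinarith [sq_nonneg (s : ℝ)]

/-- A unit vector on `ℤ/N` which is even, localized in `|y| ≤ √N`, and varies at scale `√N`. -/
lemma exists_localized (N : ℕ) [NeZero N] : ∃ φ : ZMod N → ℝ, (∀ y, φ (-y) = φ y) ∧
    ∑ y, φ y ^ 2 = 1 ∧ (∀ m : ℤ, ∑ y, (φ y - φ (y - m)) ^ 2 ≤ 128 * (m : ℝ) ^ 2 / N) ∧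
    ∀ y, φ y ≠ 0 → (y.valMinAbs : ℝ) ^ 2 ≤ N := by
  have hN : 0 < N := Nat.pos_of_ne_zero (NeZero.ne N)
  have hs : 0 < N.sqrt := Nat.sqrt_pos.2 hN
  have hsR : (0 : ℝ) < N.sqrt := by exact_mod_cast hs
  have hNR : (0 : ℝ) < N := by exact_mod_cast hN
  have hT := le_sum_sq_tent N
  set T := ∑ y : ZMod N, tent N y ^ 2
  have hTpos : 0 < T := lt_of_lt_of_le (by positivity) hT
  have hsq : Real.sqrt T ^ 2 = T := Real.sq_sqrt hTpos.le
  have hsqpos : 0 < Real.sqrt T := Real.sqrt_pos.2 hTpos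
  refine ⟨fun y => tent N y / Real.sqrt T, fun y => by simp only [tent_neg], ?_, fun m => ?_, ?_⟩
  · simp only [div_pow, hsq]
    rw [← Finset.sum_div]
    exact div_self hTpos.ne'
  · simp only [← sub_div, div_pow, hsq]
    rw [← Finset.sum_div]
    refine (div_le_div_of_nonneg_right (sum_sq_tent_sub_le N m) hTpos.le).trans ?_
    refine (div_le_div_of_nonneg_left (by positivity) (by positivity) hT).trans ?_
    -- The quotient of the two tent bounds is `32 m²/s²`; the constant `128` comes from `N < (s +
    -- 1)² ≤ 4s²`.
    have h4 : (N : ℝ) ≤ 4 * (N.sqrt : ℝ) ^ 2 := by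
      have h5 : N ≤ 4 * N.sqrt ^ 2 := by
        have := Nat.lt_succ_sqrt N
        simp only [Nat.succ_eq_add_one] at this
        nlinarith
      exact_mod_cast h5
    rw [div_le_div_iff₀ (by positivity) hNR]
    have : 0 ≤ (N.sqrt : ℝ) * (m : ℝ) ^ 2 := by positivity
    nlinarith [mul_le_mul_of_nonneg_left h4 this]
  · intro y hy
    have h1 := natAbs_valMinAbs_lt_of_tent_ne_zero (fun h => hy (by simp [h]) : tent N y ≠ 0)
    have h2 : y.valMinAbs.natAbs ^ 2 ≤ N :=
      (Nat.pow_le_pow_left h1.le 2).trans (Nat.sqrt_le' N)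
    have h3 : (y.valMinAbs : ℝ) ^ 2 = ((y.valMinAbs.natAbs ^ 2 : ℕ) : ℝ) := by
      push_cast; rw [Nat.cast_natAbs, Int.cast_abs, sq_abs]
    rw [h3]
    exact_mod_cast h2

/-! ### Characters of `ℤ/N` and expectations of Weyl translations -/

lemma stdAddChar_intCast (N : ℕ) [NeZero N] (k : ℤ) :
    ZMod.stdAddChar (k : ZMod N) = exp2pi ((k : ℝ) / N) := by
  rw [ZMod.stdAddChar_coe, exp2pi]
  congr 1
  push_cast
  ring

lemma norm_stdAddChar {N : ℕ} [NeZero N] (x : ZMod N) : ‖ZMod.stdAddChar x‖ = 1 := by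
  rw [ZMod.stdAddChar_apply]; exact Circle.norm_coe _

lemma conj_stdAddChar {N : ℕ} [NeZero N] (x : ZMod N) :
    (starRingEnd ℂ) (ZMod.stdAddChar x) = ZMod.stdAddChar (-x) := by
  rw [ZMod.stdAddChar_apply, ZMod.stdAddChar_apply, AddChar.map_neg_eq_inv, Circle.coe_inv_eq_conj]

lemma conj_exp2pi (t : ℝ) : (starRingEnd ℂ) (exp2pi t) = exp2pi (-t) := by
  rw [exp2pi, exp2pi, ← Complex.exp_conj]
  congr 1
  rw [map_mul, Complex.conj_ofReal, Complex.conj_I]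
  push_cast
  ring

lemma exp2pi_re (t : ℝ) : (exp2pi t).re = Real.cos (2 * Real.pi * t) := by
  rw [exp2pi, Complex.exp_ofReal_mul_I_re]

lemma norm_exp2pi_sub_one_le (t : ℝ) : ‖exp2pi t - 1‖ ≤ 2 * Real.pi * |t| := by
  have h := Real.norm_exp_I_mul_ofReal_sub_one_le (x := 2 * Real.pi * t)
  rw [mul_comm Complex.I] at h
  refine h.trans_eq ?_
  rw [Real.norm_eq_abs, abs_mul, abs_of_pos (by positivity : 0 < 2 * Real.pi)]

/-- The expectation of the Weyl translation by `(l, m)` in the real state `φ` on `ℤ/N`. -/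
def weylExpect {N : ℕ} [NeZero N] (φ : ZMod N → ℝ) (l m : ℤ) : ℂ :=
  (∑ y : ZMod N, ((φ y * φ (y - m) : ℝ) : ℂ) * ZMod.stdAddChar (-((l : ZMod N) * y))) *
    exp2pi (l * m / (2 * N))

section Localized

variable {N : ℕ} [NeZero N] {φ : ZMod N → ℝ}

lemma sum_shift_sq (hφ : ∑ y, φ y ^ 2 = 1) (m : ZMod N) : ∑ y, φ (y - m) ^ 2 = 1 := by
  rw [← hφ]
  exact Equiv.sum_comp (Equiv.subRight m) (fun y => φ y ^ 2)

lemma norm_weylExpect_le_one (hφ : ∑ y, φ y ^ 2 = 1) (l m : ℤ) : ‖weylExpect φ l m‖ ≤ 1 := by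
  rw [weylExpect, norm_mul, norm_exp2pi, mul_one]
  refine (norm_sum_le _ _).trans ?_
  have h1 : ∀ y : ZMod N, ‖((φ y * φ (y - m) : ℝ) : ℂ) * ZMod.stdAddChar (-((l : ZMod N) * y))‖ ≤
      (φ y ^ 2 + φ (y - m) ^ 2) / 2 := by
    intro y
    rw [norm_mul, norm_stdAddChar, mul_one, Complex.norm_real, Real.norm_eq_abs, abs_mul,
      ← sq_abs (φ y), ← sq_abs (φ (y - m))]
    nlinarith [sq_nonneg (|φ y| - |φ (y - m)|)]
  refine (Finset.sum_le_sum fun y _ => h1 y).trans ?_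
  rw [← Finset.sum_div, Finset.sum_add_distrib, hφ, sum_shift_sq hφ]
  norm_num

/-- The reflection `y ↦ m - y` exchanges `φ y` and `φ (y - m)` by evenness. The half phase
`exp(πilm/N)` centres the character at the fixed point `m/2`, so the reflection also conjugates the
total phase. Reality removes the first-order term in the phase, which would only be `O(N^{-1/2})`.
-/
lemma weylExpect_conj (heven : ∀ y, φ (-y) = φ y) (l m : ℤ) :
    (starRingEnd ℂ) (weylExpect φ l m) = weylExpect φ l m := by
  rw [weylExpect, map_mul, map_sum]
  have h1 : ∑ y : ZMod N, (starRingEnd ℂ)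
      (((φ y * φ (y - m) : ℝ) : ℂ) * ZMod.stdAddChar (-((l : ZMod N) * y))) =
      ∑ y : ZMod N, (((φ y * φ (y - m) : ℝ) : ℂ) * ZMod.stdAddChar (-((l : ZMod N) * y))) *
        exp2pi (l * m / N) := by
    rw [← Equiv.sum_comp (Equiv.subLeft (m : ZMod N))]
    refine Finset.sum_congr rfl fun y _ => ?_
    have e1 : φ (m - y) = φ (y - m) := by rw [← heven, neg_sub]
    have e2 : φ (m - y - m) = φ y := by rw [← heven]; congr 1; ring
    have e3 : exp2pi ((l : ℝ) * m / N) = ZMod.stdAddChar ((l : ZMod N) * (m : ZMod N)) := by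
      have := stdAddChar_intCast N (l * m)
      push_cast at this
      exact this.symm
    rw [Equiv.subLeft_apply, map_mul, Complex.conj_ofReal, conj_stdAddChar, e1, e2, e3, mul_assoc,
      ← AddChar.map_add_eq_mul, mul_comm (φ y)]
    congr 2
    ring
  rw [h1, ← Finset.sum_mul, mul_assoc, conj_exp2pi, ← exp2pi_add]
  congr 2
  ring

/-- Two second-order errors add up: the translation in position costs half of `∑ (φ y - φ (y -
m))²`, and the phase costs `1 - cos`, quadratic in an angle of size `N^{-1/2}` on the support of
`φ`. The constant is `104 = 128/2 + 40`. -/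
lemma norm_one_sub_weylExpect_le (heven : ∀ y, φ (-y) = φ y) (hφ : ∑ y, φ y ^ 2 = 1)
    (hshift : ∀ m : ℤ, ∑ y, (φ y - φ (y - m)) ^ 2 ≤ 128 * (m : ℝ) ^ 2 / N)
    (hsupp : ∀ y, φ y ≠ 0 → (y.valMinAbs : ℝ) ^ 2 ≤ N) (l m : ℤ) :
    ‖1 - weylExpect φ l m‖ ≤ 104 * (1 + (l : ℝ) ^ 2) * (1 + (m : ℝ) ^ 2) / N := by
  have hN1 : (1 : ℝ) ≤ N := by exact_mod_cast Nat.one_le_iff_ne_zero.2 (NeZero.ne N)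
  have hN : (0 : ℝ) < N := by linarith
  -- The character depends only on the residue of `y`, so the representative nearest to `0` may be
  -- used; this is what makes the angle small.
  set θ : ZMod N → ℝ := fun y => -(l * y.valMinAbs) / N + l * m / (2 * N) with hθ
  have hre : (weylExpect φ l m).re = ∑ y, φ y * φ (y - m) * Real.cos (2 * Real.pi * θ y) := by
    rw [weylExpect, Finset.sum_mul, Complex.re_sum]
    refine Finset.sum_congr rfl fun y _ => ?_
    have e : ZMod.stdAddChar (-((l : ZMod N) * y)) = exp2pi (-(l * y.valMinAbs) / N) := by
      have := stdAddChar_intCast N (-(l * y.valMinAbs))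
      push_cast [ZMod.coe_valMinAbs] at this
      exact this
    rw [e, mul_assoc, ← exp2pi_add, Complex.re_ofReal_mul, exp2pi_re]
  have hreal : weylExpect φ l m = ((weylExpect φ l m).re : ℂ) :=
    (Complex.conj_eq_iff_re.1 (weylExpect_conj heven l m)).symm
  rw [hreal, ← Complex.ofReal_one, ← Complex.ofReal_sub, Complex.norm_real, Real.norm_eq_abs, hre]
  -- Writing `1` symmetrically in `φ y` and `φ (y - m)` lets it cancel against the products up to
  -- squares of differences.
  have hone : (1 : ℝ) = ∑ y, (φ y ^ 2 + φ (y - m) ^ 2) / 2 := by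
    rw [← Finset.sum_div, Finset.sum_add_distrib, hφ, sum_shift_sq hφ]
    norm_num
  set B : ℝ := 40 * (l : ℝ) ^ 2 * (1 + (m : ℝ) ^ 2) / N with hB
  have hB0 : 0 ≤ B := by positivity
  have hpt : ∀ y, |(φ y ^ 2 + φ (y - m) ^ 2) / 2 - φ y * φ (y - m) * Real.cos (2 * Real.pi * θ y)| ≤
      (φ y - φ (y - m)) ^ 2 / 2 + (φ y ^ 2 + φ (y - m) ^ 2) / 2 * B := by
    intro y
    have hcos : φ y ≠ 0 → 1 - Real.cos (2 * Real.pi * θ y) ≤ B := by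
      intro hy
      have h1 := Real.one_sub_sq_div_two_le_cos (x := 2 * Real.pi * θ y)
      have h2 : θ y ^ 2 ≤ 2 * (l : ℝ) ^ 2 * (1 + (m : ℝ) ^ 2) / N := by
        have h3 : θ y = l * (m / 2 - y.valMinAbs) / N := by rw [hθ]; field_simp; ring
        rw [h3, div_pow, div_le_div_iff₀ (by positivity) hN]
        have h4 : ((m : ℝ) / 2 - y.valMinAbs) ^ 2 ≤ 2 * (1 + (m : ℝ) ^ 2) * N := by
          have := hsupp y hy
          have h5 : (m : ℝ) ^ 2 ≤ (m : ℝ) ^ 2 * N := le_mul_of_one_le_right (sq_nonneg _) hN1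
          nlinarith [sq_nonneg ((m : ℝ) / 2 + y.valMinAbs)]
        have h6 : 0 ≤ (l : ℝ) ^ 2 * N := by positivity
        nlinarith [mul_le_mul_of_nonneg_left h4 h6]
      have hpi : Real.pi ^ 2 ≤ 10 := by nlinarith [Real.pi_lt_d2, Real.pi_pos]
      have h7 : (2 * Real.pi * θ y) ^ 2 / 2 ≤ B := by
        have h8 : (2 * Real.pi * θ y) ^ 2 / 2 = 2 * Real.pi ^ 2 * θ y ^ 2 := by ring
        rw [h8]
        have h9 : B = 20 * (2 * (l : ℝ) ^ 2 * (1 + (m : ℝ) ^ 2) / N) := by rw [hB]; ring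
        rw [h9]
        have := sq_nonneg (θ y)
        nlinarith
      linarith
    have hcos1 : 0 ≤ 1 - Real.cos (2 * Real.pi * θ y) := by linarith [Real.cos_le_one (2 * Real.pi * θ y)]
    have hab : |φ y * φ (y - m)| ≤ (φ y ^ 2 + φ (y - m) ^ 2) / 2 := by
      rw [abs_le]
      constructor <;> nlinarith [sq_nonneg (φ y - φ (y - m)), sq_nonneg (φ y + φ (y - m))]
    have hsecond : |φ y * φ (y - m) * (1 - Real.cos (2 * Real.pi * θ y))| ≤
        (φ y ^ 2 + φ (y - m) ^ 2) / 2 * B := by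
      -- The bound on the cosine is only available on the support of `φ`; elsewhere the product
      -- vanishes.
      by_cases hy : φ y = 0
      · rw [hy]; simp; positivity
      · rw [abs_mul, abs_of_nonneg hcos1]
        exact mul_le_mul hab (hcos hy) hcos1 (by positivity)
    have e : (φ y ^ 2 + φ (y - m) ^ 2) / 2 - φ y * φ (y - m) * Real.cos (2 * Real.pi * θ y) =
      (φ y - φ (y - m)) ^ 2 / 2 + φ y * φ (y - m) * (1 - Real.cos (2 * Real.pi * θ y)) := by ring
    rw [e]
    refine (abs_add_le _ _).trans ?_
    rw [abs_of_nonneg (by positivity : 0 ≤ (φ y - φ (y - m)) ^ 2 / 2)]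
    linarith
  calc |1 - ∑ y, φ y * φ (y - m) * Real.cos (2 * Real.pi * θ y)|
      = |∑ y, ((φ y ^ 2 + φ (y - m) ^ 2) / 2 - φ y * φ (y - m) * Real.cos (2 * Real.pi * θ y))| := by
        rw [Finset.sum_sub_distrib, ← hone]
    _ ≤ ∑ y, ((φ y - φ (y - m)) ^ 2 / 2 + (φ y ^ 2 + φ (y - m) ^ 2) / 2 * B) :=
        (Finset.abs_sum_le_sum_abs _ _).trans (Finset.sum_le_sum fun y _ => hpt y)
    _ = (∑ y, (φ y - φ (y - m)) ^ 2) / 2 + B := by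
        rw [Finset.sum_add_distrib, ← Finset.sum_div, ← Finset.sum_mul, ← hone, one_mul]
    _ ≤ 128 * (m : ℝ) ^ 2 / N / 2 + B := by gcongr; exact hshift m
    _ ≤ 104 * (1 + (l : ℝ) ^ 2) * (1 + (m : ℝ) ^ 2) / N := by
        rw [hB, div_div, div_add_div _ _ (by positivity) hN.ne', div_le_div_iff₀ (by positivity) hN]
        have h1 : 0 ≤ (N : ℝ) * N := by positivity
        have h2 : 128 * (m : ℝ) ^ 2 + 2 * (40 * (l : ℝ) ^ 2 * (1 + (m : ℝ) ^ 2)) ≤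
            2 * (104 * (1 + (l : ℝ) ^ 2) * (1 + (m : ℝ) ^ 2)) := by
          have : 0 ≤ (l : ℝ) ^ 2 * (m : ℝ) ^ 2 := by positivity
          nlinarith [sq_nonneg (l : ℝ), sq_nonneg (m : ℝ)]
        nlinarith [mul_le_mul_of_nonneg_left h2 h1]

end Localized

/-- A unit vector on `ℤ/N` in which all Weyl translations have expectation `1 + O(1/N)`. -/
lemma exists_weylExpect_near_one (N : ℕ) [NeZero N] : ∃ φ : ZMod N → ℝ, ∑ y, φ y ^ 2 = 1 ∧
    ∀ l m : ℤ, ‖1 - weylExpect φ l m‖ ≤ 104 * (1 + (l : ℝ) ^ 2) * (1 + (m : ℝ) ^ 2) / N := by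
  obtain ⟨φ, h1, h2, h3, h4⟩ := exists_localized N
  exact ⟨φ, h2, norm_one_sub_weylExpect_le h1 h2 h3 h4⟩

/-! ### Coherent states on `(ℤ/N)ⁿ` -/

section Coherent

open scoped ComplexConjugate

variable {n N : ℕ}

/-- The reduction modulo `N` of an integer vector. -/
def modVec (N : ℕ) (l : Fin n → ℤ) : Fin n → ZMod N := fun i => (l i : ZMod N)

lemma modVec_sub (l m : Fin n → ℤ) : modVec N (l - m) = modVec N l - modVec N m := by
  ext i; simp [modVec]

variable [NeZero N]

/-- The character `exp(2πi⟨x, y⟩/N)` of `(ℤ/N)ⁿ`. -/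
def pairing (x y : Fin n → ZMod N) : ℂ := ZMod.stdAddChar (∑ i, x i * y i)

lemma pairing_comm (x y : Fin n → ZMod N) : pairing x y = pairing y x := by
  simp only [pairing, mul_comm]

lemma pairing_add_right (x y z : Fin n → ZMod N) :
    pairing x (y + z) = pairing x y * pairing x z := by
  simp only [pairing, Pi.add_apply, mul_add, Finset.sum_add_distrib, AddChar.map_add_eq_mul]

lemma pairing_add_left (x y z : Fin n → ZMod N) :
    pairing (x + y) z = pairing x z * pairing y z := by
  rw [pairing_comm, pairing_add_right, pairing_comm z, pairing_comm z]

lemma pairing_neg_left (x y : Fin n → ZMod N) : pairing (-x) y = pairing x (-y) := by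
  simp [pairing]

lemma conj_pairing (x y : Fin n → ZMod N) : conj (pairing x y) = pairing x (-y) := by
  simp [pairing, conj_stdAddChar]

lemma norm_pairing (x y : Fin n → ZMod N) : ‖pairing x y‖ = 1 := norm_stdAddChar _

lemma pairing_zero_left (y : Fin n → ZMod N) : pairing 0 y = 1 := by simp [pairing]

lemma pairing_eq_prod (x y : Fin n → ZMod N) :
    pairing x y = ∏ i, ZMod.stdAddChar (x i * y i) := by
  have h := map_prod (AddChar.toMonoidHom (ZMod.stdAddChar (N := N)))
    (fun i => Multiplicative.ofAdd (x i * y i)) Finset.univ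
  rw [← ofAdd_sum] at h
  exact h

lemma sum_pairing (z : Fin n → ZMod N) :
    ∑ ξ : Fin n → ZMod N, pairing ξ z = if z = 0 then (N : ℂ) ^ n else 0 := by
  simp only [pairing_eq_prod]
  rw [← Fintype.prod_sum (fun i (x : ZMod N) => ZMod.stdAddChar (x * z i))]
  simp only [AddChar.sum_mulShift _ (ZMod.isPrimitive_stdAddChar N), ZMod.card]
  split_ifs with h
  · simp [h]
  · obtain ⟨i, hi⟩ := Function.ne_iff.1 h
    exact Finset.prod_eq_zero (Finset.mem_univ i) (by rw [if_neg (by simpa using hi), Nat.cast_zero])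

/-- The product state `φ ⊗ ⋯ ⊗ φ`. -/
def prodState (n : ℕ) (φ : ZMod N → ℝ) (j : Fin n → ZMod N) : ℝ := ∏ i, φ (j i)

lemma sum_prodState_sq {φ : ZMod N → ℝ} (hφ : ∑ y, φ y ^ 2 = 1) :
    ∑ j, prodState n φ j ^ 2 = 1 := by
  simp only [prodState, ← Finset.prod_pow]
  rw [← Fintype.prod_sum (fun _ (y : ZMod N) => φ y ^ 2)]
  simp [hφ]

/-- The pairing of `v` with the translation of `Φ` in phase space by `(x, ξ)`. -/
def coherent (Φ : (Fin n → ZMod N) → ℝ) (x ξ : Fin n → ZMod N) (v : (Fin n → ZMod N) → ℂ) : ℂ :=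
  ∑ j, (Φ (j - x) : ℂ) * pairing ξ (-j) * v j

/-- The quadratic form of a phase space translation, up to a phase. -/
def corr (v : (Fin n → ZMod N) → ℂ) (l m : Fin n → ZMod N) : ℂ :=
  ∑ j, pairing l j * (conj (v (j - m)) * v j)

/-- Expanding the square gives a double sum over `j, k`; the sum over momenta is a character sum,
which by orthogonality (`sum_pairing`) keeps only `k = j - m`. -/
lemma sum_momentum_coherent (Φ : (Fin n → ZMod N) → ℝ) (v : (Fin n → ZMod N) → ℂ)
    (x m : Fin n → ZMod N) :
    ∑ ξ, pairing m ξ * (coherent Φ x ξ v * conj (coherent Φ x ξ v)) =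
      N ^ n * ∑ j, ((Φ (j - x) * Φ (j - m - x) : ℝ) : ℂ) * (conj (v (j - m)) * v j) := by
  have h1 : ∀ ξ, pairing m ξ * (coherent Φ x ξ v * conj (coherent Φ x ξ v)) =
      ∑ j, ∑ k, (((Φ (j - x) * Φ (k - x) : ℝ) : ℂ) * (conj (v k) * v j)) * pairing ξ (m + k - j) := by
    intro ξ
    simp only [coherent, map_sum, map_mul, Complex.conj_ofReal, conj_pairing]
    rw [Finset.sum_mul_sum, Finset.mul_sum]
    refine Finset.sum_congr rfl fun j _ => ?_
    rw [Finset.mul_sum]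
    refine Finset.sum_congr rfl fun k _ => ?_
    rw [sub_eq_add_neg (m + k), pairing_add_right, pairing_add_right, neg_neg, pairing_comm m ξ]
    push_cast
    ring
  simp only [h1]
  rw [Finset.sum_comm, Finset.mul_sum]
  refine Finset.sum_congr rfl fun j _ => ?_
  rw [Finset.sum_comm]
  simp only [← Finset.mul_sum, sum_pairing]
  rw [Finset.sum_eq_single (j - m)]
  · rw [if_pos (by abel)]; ring
  · intro k _ hk
    rw [if_neg, mul_zero]
    intro h
    apply hk
    rw [eq_sub_iff_add_eq, ← sub_eq_zero, ← h]
    abel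
  · simp

/-- The symbol `exp(2πi(⟨l, x⟩ + ⟨m, ξ⟩)/N)` is quantized by coherent states to a multiple of the
corresponding phase space translation. -/
lemma sum_coherent (Φ : (Fin n → ZMod N) → ℝ) (v : (Fin n → ZMod N) → ℂ)
    (l m : Fin n → ZMod N) :
    ∑ x, ∑ ξ, pairing l x * pairing m ξ * (coherent Φ x ξ v * conj (coherent Φ x ξ v)) =
      N ^ n * ((∑ y, ((Φ y * Φ (y - m) : ℝ) : ℂ) * pairing l (-y)) * corr v l m) := by
  simp only [mul_assoc, ← Finset.mul_sum]
  simp only [sum_momentum_coherent]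
  simp only [mul_left_comm _ ((N : ℂ) ^ n), ← Finset.mul_sum]
  congr 1
  simp only [Finset.mul_sum]
  rw [Finset.sum_comm, corr]
  simp only [Finset.mul_sum]
  refine Finset.sum_congr rfl fun j _ => ?_
  -- With `y = j - x` the dependence on `Φ` separates from that on `v`: `pairing l x` splits into
  -- `pairing l j`, which goes to `corr`, and `pairing l (-y)`.
  rw [← Equiv.sum_comp (Equiv.subLeft j), Finset.sum_mul]
  refine Finset.sum_congr rfl fun y _ => ?_
  simp only [Equiv.subLeft_apply]
  rw [show j - (j - y) = y by abel, show j - m - (j - y) = y - m by abel, sub_eq_add_neg j y,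
    pairing_add_right]
  ring

lemma norm_corr_le (v : (Fin n → ZMod N) → ℂ) (l m : Fin n → ZMod N) :
    ‖corr v l m‖ ≤ ∑ j, ‖v j‖ ^ 2 := by
  have h1 : ∀ j, ‖pairing l j * (conj (v (j - m)) * v j)‖ ≤ (‖v (j - m)‖ ^ 2 + ‖v j‖ ^ 2) / 2 := by
    intro j
    rw [norm_mul, norm_pairing, one_mul, norm_mul, RCLike.norm_conj]
    nlinarith [sq_nonneg (‖v (j - m)‖ - ‖v j‖)]
  refine (norm_sum_le _ _).trans ((Finset.sum_le_sum fun j _ => h1 j).trans_eq ?_)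
  have h2 : ∑ j, ‖v (j - m)‖ ^ 2 = ∑ j, ‖v j‖ ^ 2 :=
    Equiv.sum_comp (Equiv.subRight m) (fun j => ‖v j‖ ^ 2)
  rw [← Finset.sum_div, Finset.sum_add_distrib, h2]
  ring

lemma corr_zero (v : (Fin n → ZMod N) → ℂ) : corr v 0 0 = ((∑ j, ‖v j‖ ^ 2 : ℝ) : ℂ) := by
  simp only [corr, pairing_zero_left, sub_zero, one_mul, Complex.conj_mul']
  push_cast
  rfl

/-- The resolution of identity by coherent states. -/
lemma sum_norm_coherent_sq {Φ : (Fin n → ZMod N) → ℝ} (hΦ : ∑ j, Φ j ^ 2 = 1)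
    (v : (Fin n → ZMod N) → ℂ) :
    ∑ x, ∑ ξ, ‖coherent Φ x ξ v‖ ^ 2 = (N : ℝ) ^ n * ∑ j, ‖v j‖ ^ 2 := by
  have h := sum_coherent Φ v 0 0
  simp only [pairing_zero_left, one_mul, sub_zero, corr_zero, Complex.mul_conj',
    mul_one] at h
  simp only [← sq] at h
  have h2 : ∑ y, ((Φ y ^ 2 : ℝ) : ℂ) = 1 := by exact_mod_cast congrArg Complex.ofReal hΦ
  rw [h2, one_mul] at h
  exact_mod_cast h

/-- Telescoping with `1 - ab = (1 - a) + a(1 - b)`. It transfers the one-dimensional expectation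
estimate to dimension `n`. -/
lemma norm_one_sub_prod_le {ι : Type*} (s : Finset ι) (a : ι → ℂ) (ha : ∀ i ∈ s, ‖a i‖ ≤ 1) :
    ‖1 - ∏ i ∈ s, a i‖ ≤ ∑ i ∈ s, ‖1 - a i‖ := by
  classical
  induction s using Finset.induction_on with
  | empty => simp
  | insert i s hi ih =>
    rw [Finset.prod_insert hi, Finset.sum_insert hi]
    have e : 1 - a i * ∏ j ∈ s, a j = (1 - a i) + a i * (1 - ∏ j ∈ s, a j) := by ring
    rw [e]
    refine (norm_add_le _ _).trans (add_le_add le_rfl ?_)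
    rw [norm_mul]
    have h1 := ih fun j hj => ha j (Finset.mem_insert_of_mem hj)
    have h2 := ha i (Finset.mem_insert_self i s)
    nlinarith [norm_nonneg (1 - ∏ j ∈ s, a j)]

lemma exp2pi_sum {ι : Type*} (s : Finset ι) (t : ι → ℝ) :
    exp2pi (∑ i ∈ s, t i) = ∏ i ∈ s, exp2pi (t i) := by
  classical
  induction s using Finset.induction_on with
  | empty => simp [exp2pi]
  | insert i s hi ih => rw [Finset.sum_insert hi, Finset.prod_insert hi, exp2pi_add, ih]

/-- For a product state the sum factorizes over coordinates, so the multiplier in `sum_coherent` is,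
up to the half phase, a product of one-dimensional expectations. -/
lemma prod_weylExpect (φ : ZMod N → ℝ) (l m : Fin n → ℤ) :
    ∏ i, weylExpect φ (l i) (m i) =
      (∑ y, ((prodState n φ y * prodState n φ (y - modVec N m) : ℝ) : ℂ) *
        pairing (modVec N l) (-y)) * exp2pi ((∑ i, (l i : ℝ) * m i) / (2 * N)) := by
  simp only [weylExpect]
  rw [Finset.prod_mul_distrib, Finset.sum_div, exp2pi_sum, Fintype.prod_sum]
  congr 1
  refine Finset.sum_congr rfl fun y _ => ?_
  rw [Finset.prod_mul_distrib, pairing_eq_prod, prodState, prodState, ← Finset.prod_mul_distrib]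
  push_cast
  simp [modVec, Finset.prod_mul_distrib]

end Coherent

/-! ### Weighted summability of Fourier coefficients -/

/-- The weight `1 + |k|²`. -/
def freqWeight {d : Type*} [Fintype d] (k : d → ℤ) : ℝ := 1 + ∑ i, (k i : ℝ) ^ 2

section Weight

variable {d : Type*} [Fintype d]

lemma one_le_freqWeight (k : d → ℤ) : 1 ≤ freqWeight k :=
  le_add_of_nonneg_right (Finset.sum_nonneg fun _ _ => sq_nonneg _)

lemma one_add_sq_le_freqWeight (k : d → ℤ) (i : d) : 1 + (k i : ℝ) ^ 2 ≤ freqWeight k :=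
  add_le_add le_rfl
    (Finset.single_le_sum (f := fun i => (k i : ℝ) ^ 2) (fun _ _ => sq_nonneg _) (Finset.mem_univ i))

/-- A Peetre-type inequality: errors at the frequency `q - r` are distributed to `q` and `r`, so
that the double series is dominated by a product. -/
lemma freqWeight_sub_le (k l : d → ℤ) : freqWeight (k - l) ≤ 2 * (freqWeight k * freqWeight l) := by
  have h : ∑ i, ((k - l) i : ℝ) ^ 2 ≤ 2 * ∑ i, (k i : ℝ) ^ 2 + 2 * ∑ i, (l i : ℝ) ^ 2 := by
    rw [Finset.mul_sum, Finset.mul_sum, ← Finset.sum_add_distrib]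
    refine Finset.sum_le_sum fun i _ => ?_
    rw [Pi.sub_apply]
    push_cast
    nlinarith [sq_nonneg ((k i : ℝ) + l i)]
  have hk : 0 ≤ ∑ i, (k i : ℝ) ^ 2 := Finset.sum_nonneg fun _ _ => sq_nonneg _
  have hl : 0 ≤ ∑ i, (l i : ℝ) ^ 2 := Finset.sum_nonneg fun _ _ => sq_nonneg _
  unfold freqWeight
  nlinarith [mul_nonneg hk hl]

/-- Repeated integration by parts in the coordinate where `|k i|` is largest gives any power of
decay. The squared weight grows like the fourth power of the sup norm `r`, so decay of order `M + 4`
leaves the summable `r^{-M}`. -/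
lemma PeriodicSmooth.summable_weighted {G : (d → ℝ) → ℂ} (h : PeriodicSmooth G)
    (g : C(UnitAddTorus d, ℂ)) (hg : ∀ w, g (torusPt w) = G w) :
    Summable fun k => ‖UnitAddTorus.mFourierCoeff g k‖ * freqWeight k ^ 2 := by
  classical
  obtain ⟨M, hM, hs⟩ := summable_int_norm d
  choose B hB using fun i => h.iter i g hg (M + 4)
  have hB0 : ∀ i, 0 ≤ B i := fun i => le_trans (by positivity) (hB i 0)
  refine Summable.of_norm_bounded_eventually
    (hs.mul_left ((1 + Fintype.card d : ℝ) ^ 2 * ∑ i, B i)) ?_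
  rw [Filter.eventually_cofinite]
  refine (Set.finite_singleton (0 : d → ℤ)).subset fun k hk => ?_
  by_contra hk0
  apply hk
  have hk0 : k ≠ 0 := hk0
  obtain ⟨j, hj⟩ := Function.ne_iff.1 hk0
  have : Nonempty d := ⟨j⟩
  obtain ⟨i, hi⟩ := Finite.exists_max (fun i => ‖(k i : ℝ)‖)
  set r : ℝ := ‖(fun i => (k i : ℝ) : d → ℝ)‖ with hr
  have hri : r ≤ ‖(k i : ℝ)‖ := (pi_norm_le_iff_of_nonneg (norm_nonneg _)).2 hi
  have hle : ∀ i, ‖(k i : ℝ)‖ ≤ r := fun i => norm_le_pi_norm (fun i => (k i : ℝ)) i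
  have hr1 : 1 ≤ r := by
    refine le_trans ?_ (hle j)
    rw [Real.norm_eq_abs, ← Int.cast_abs]
    exact_mod_cast Int.one_le_abs hj
  have hW : freqWeight k ≤ (1 + Fintype.card d) * r ^ 2 := by
    have h1 : ∑ i, (k i : ℝ) ^ 2 ≤ ∑ _i : d, r ^ 2 := by
      refine Finset.sum_le_sum fun i _ => ?_
      rw [← sq_abs, ← Real.norm_eq_abs]
      exact pow_le_pow_left₀ (norm_nonneg _) (hle i) 2
    rw [Finset.sum_const, nsmul_eq_mul, Finset.card_univ] at h1
    unfold freqWeight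
    nlinarith
  have hW0 : 0 ≤ freqWeight k := zero_le_one.trans (one_le_freqWeight k)
  rw [Real.norm_of_nonneg (by positivity), inv_pow, ← div_eq_mul_inv, le_div_iff₀ (by positivity)]
  calc ‖UnitAddTorus.mFourierCoeff g k‖ * freqWeight k ^ 2 * r ^ M
      ≤ ‖UnitAddTorus.mFourierCoeff g k‖ * ((1 + Fintype.card d) * r ^ 2) ^ 2 * r ^ M := by gcongr
    _ = (1 + Fintype.card d : ℝ) ^ 2 * (r ^ (M + 4) * ‖UnitAddTorus.mFourierCoeff g k‖) := by ring
    _ ≤ (1 + Fintype.card d : ℝ) ^ 2 * (‖(k i : ℝ)‖ ^ (M + 4) * ‖UnitAddTorus.mFourierCoeff g k‖) := by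
        gcongr
    _ ≤ (1 + Fintype.card d : ℝ) ^ 2 * ∑ i, B i := by
        gcongr
        exact (hB i k).trans (Finset.single_le_sum (fun i _ => hB0 i) (Finset.mem_univ i))

end Weight

/-! ### Both quadratic forms as double Fourier series -/

section Expansion

open scoped RealInnerProductSpace ComplexConjugate

variable {n : ℕ}

/-- The position component of a frequency. -/
def fstFreq (q : Fin n ⊕ Fin n → ℤ) : Fin n → ℤ := fun i => q (Sum.inl i)

/-- The momentum component of a frequency. -/
def sndFreq (q : Fin n ⊕ Fin n → ℤ) : Fin n → ℤ := fun i => q (Sum.inr i)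

lemma IsSmoothOnTorus.fourier_weighted
    {f : EuclideanSpace ℝ (Fin n) × EuclideanSpace ℝ (Fin n) → ℂ} (hf : IsSmoothOnTorus f) :
    ∃ c : (Fin n ⊕ Fin n → ℤ) → ℂ, Summable (fun q => ‖c q‖ * freqWeight q ^ 2) ∧ ∀ x ξ,
      HasSum (fun q => c q * exp2pi (⟪intVec (fstFreq q), x⟫ + ⟪intVec (sndFreq q), ξ⟫))
        (f (x, ξ)) := by
  let G : (Fin n ⊕ Fin n → ℝ) → ℂ := fun w =>
    f (WithLp.toLp 2 (fun i => w (Sum.inl i)), WithLp.toLp 2 (fun i => w (Sum.inr i)))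
  have hG : PeriodicSmooth G := by
    refine ⟨?_, ?_⟩
    · refine hf.contDiff.comp (ContDiff.prodMk ?_ ?_)
      · exact (PiLp.contDiff_toLp).comp (contDiff_pi.2 fun i => contDiff_apply ℝ ℝ _)
      · exact (PiLp.contDiff_toLp).comp (contDiff_pi.2 fun i => contDiff_apply ℝ ℝ _)
    · intro k w
      exact hf.periodic (fun i => k (Sum.inl i)) (fun i => k (Sum.inr i))
        (WithLp.toLp 2 (fun i => w (Sum.inl i))) (WithLp.toLp 2 (fun i => w (Sum.inr i)))
  obtain ⟨g, hg⟩ := hG.desc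
  refine ⟨UnitAddTorus.mFourierCoeff g, hG.summable_weighted g hg, fun x ξ => ?_⟩
  have := UnitAddTorus.hasSum_mFourier_series_apply_of_summable (hG.summable g hg)
    (torusPt (Sum.elim x ξ))
  simp only [mFourier_torusPt, hg, smul_eq_mul, G, Sum.elim_inl, Sum.elim_inr] at this
  convert this using 3 with q
  rw [exp2pi, inner_intVec, inner_intVec]
  congr 1
  rw [Fintype.sum_sum_type]
  push_cast
  simp only [Sum.elim_inl, Sum.elim_inr, fstFreq, sndFreq]
  ring

lemma summable_norm_of_weighted {c : (Fin n ⊕ Fin n → ℤ) → ℂ}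
    (hc : Summable fun q => ‖c q‖ * freqWeight q ^ 2) : Summable fun q => ‖c q‖ :=
  Summable.of_nonneg_of_le (fun _ => norm_nonneg _) (fun q =>
    le_mul_of_one_le_right (norm_nonneg _) (one_le_pow₀ (one_le_freqWeight q))) hc

variable {N : ℕ} [NeZero N]

/-- The point `x/N` of the unit cube. -/
def residuePt (x : Fin n → ZMod N) : EuclideanSpace ℝ (Fin n) :=
  gridPt N (fun i => ((x i).val : ℤ))

lemma exp2pi_sum_val (l : Fin n → ℤ) (x : Fin n → ZMod N) :
    exp2pi ((∑ i, (l i : ℝ) * ((x i).val : ℝ)) / N) = pairing (modVec N l) x := by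
  have h := stdAddChar_intCast N (∑ i, l i * ((x i).val : ℤ))
  push_cast [ZMod.natCast_zmod_val] at h
  exact h.symm

lemma pairing_modVec (l m : Fin n → ℤ) :
    pairing (modVec N l) (modVec N m) = exp2pi ((∑ i, (l i : ℝ) * m i) / N) := by
  have h := stdAddChar_intCast N (∑ i, l i * m i)
  push_cast at h
  exact h

lemma exp2pi_inner_residuePt (l : Fin n → ℤ) (x : Fin n → ZMod N) :
    exp2pi ⟪intVec l, residuePt x⟫ = pairing (modVec N l) x := by
  rw [← exp2pi_sum_val, inner_intVec, Finset.sum_div]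
  congr 1
  refine Finset.sum_congr rfl fun i _ => ?_
  simp [residuePt, gridPt, mul_div_assoc]

lemma weylPhase_eq_pairing (j : Fin n → ZMod N) (l m : Fin n → ℤ) :
    weylPhase N j l m =
      pairing (modVec N l) j * exp2pi (-((∑ i, (l i : ℝ) * m i) / (2 * N))) := by
  rw [weylPhase, sub_eq_add_neg, exp2pi_add, exp2pi_sum_val]

lemma hasSum_mul_prod {ι : Type*} {A B : ι → ℂ} {a b : ℂ} (hA : Summable fun q => ‖A q‖)
    (hB : Summable fun q => ‖B q‖) (ha : HasSum A a) (hb : HasSum B b) :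
    HasSum (fun p : ι × ι => A p.1 * B p.2) (a * b) :=
  ha.mul hb (summable_mul_of_summable_norm hA hB)

lemma hasSum_mul_conj_self {ι : Type*} {A : ι → ℂ} {a : ℂ} (hA : Summable fun q => ‖A q‖)
    (ha : HasSum A a) :
    HasSum (fun p : ι × ι => A p.1 * conj (A p.2)) (((‖a‖ ^ 2 : ℝ) : ℂ)) := by
  have hA' : Summable fun q => ‖conj (A q)‖ := hA.congr fun q => (RCLike.norm_conj _).symm
  have h := hasSum_mul_prod hA hA' ha ha.star
  rwa [Complex.star_def, Complex.mul_conj', ← Complex.ofReal_pow] at h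

lemma hasSum_of_eq {ι : Type*} {A B : ι → ℂ} {a b : ℂ} (h : HasSum A a) (hAB : ∀ q, B q = A q)
    (hab : b = a) : HasSum B b := by
  rwa [hab, funext hAB]

/-- `‖f_N^* v‖²` as a double series in the Fourier coefficients of `f`. -/
lemma hasSum_norm_conjTranspose_mulVec_sq
    {f : EuclideanSpace ℝ (Fin n) × EuclideanSpace ℝ (Fin n) → ℂ}
    {c : (Fin n ⊕ Fin n → ℤ) → ℂ} (hc : Summable fun q => ‖c q‖)
    (hf : ∀ x ξ, HasSum (fun q => c q * exp2pi (⟪intVec (fstFreq q), x⟫ + ⟪intVec (sndFreq q), ξ⟫))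
        (f (x, ξ))) (v : (Fin n → ZMod N) → ℂ) :
    HasSum (fun p : (Fin n ⊕ Fin n → ℤ) × (Fin n ⊕ Fin n → ℤ) => c p.1 * conj (c p.2) *
      (exp2pi (-((∑ i, (fstFreq (p.1 - p.2) i : ℝ) * sndFreq (p.1 - p.2) i) / (2 * N))) *
        exp2pi ((∑ i, ((fstFreq p.1 i : ℝ) * sndFreq p.2 i - fstFreq p.2 i * sndFreq p.1 i)) / (2 * N)) *
        corr v (modVec N (fstFreq (p.1 - p.2))) (modVec N (sndFreq (p.1 - p.2)))))
      ((∑ j, ‖((quantize f N).conjTranspose.mulVec v) j‖ ^ 2 : ℝ) : ℂ) := by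
  have hN : (N : ℝ) ≠ 0 := by exact_mod_cast NeZero.ne N
  let A : (Fin n → ZMod N) → (Fin n ⊕ Fin n → ℤ) → ℂ := fun j q =>
    c q * weylPhase N j (fstFreq q) (sndFreq q) * conj (v (j - modVec N (sndFreq q)))
  have hnph : ∀ j (l m : Fin n → ℤ), ‖weylPhase N j l m‖ = 1 := fun _ _ _ => norm_exp2pi _
  obtain ⟨V, hV⟩ : ∃ V : ℝ, ∀ j, ‖v j‖ ≤ V :=
    ⟨∑ j, ‖v j‖, fun j => Finset.single_le_sum (fun _ _ => norm_nonneg _) (Finset.mem_univ j)⟩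
  have hA : ∀ j, Summable fun q => ‖A j q‖ := by
    intro j
    refine Summable.of_nonneg_of_le (fun _ => norm_nonneg _) (fun q => ?_) (hc.mul_right V)
    rw [norm_mul, norm_mul, hnph, mul_one, RCLike.norm_conj]
    exact mul_le_mul_of_nonneg_left (hV _) (norm_nonneg _)
  have hsumA : ∀ j, HasSum (A j) (conj (((quantize f N).conjTranspose.mulVec v) j)) := by
    intro j
    have hentry : ∀ p, HasSum (fun q => if (∀ i, p i = j i - (q (Sum.inr i) : ZMod N)) then
        c q * weylPhase N j (fun i => q (Sum.inl i)) (fun i => q (Sum.inr i)) else 0)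
        (quantize f N p j) := by
      intro p
      rw [quantize_eq_of_hasSum N f c hc hf]
      refine Summable.hasSum (Summable.of_norm_bounded hc fun q => ?_)
      split_ifs
      · rw [norm_mul, hnph, mul_one]
      · simp
    have h1 := hasSum_sum fun p (_ : p ∈ Finset.univ) => (hentry p).mul_right (conj (v p))
    have e1 : conj (((quantize f N).conjTranspose.mulVec v) j) =
        ∑ p, quantize f N p j * conj (v p) := by
      simp [Matrix.mulVec, dotProduct, Matrix.conjTranspose_apply]
    refine hasSum_of_eq h1 (fun q => ?_) e1
    -- Each frequency is quantized to a translation, which has exactly one nonzero entry in the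
    -- column `j`.
    rw [Finset.sum_eq_single (j - modVec N (sndFreq q))]
    · rw [if_pos (show ∀ i, (j - modVec N (sndFreq q)) i = j i - (q (Sum.inr i) : ZMod N) from
        fun i => rfl)]
      rfl
    · intro p _ hp
      rw [if_neg (show ¬∀ i, p i = j i - (q (Sum.inr i) : ZMod N) from fun h => hp (funext h)),
        zero_mul]
    · simp
  have h2 := hasSum_sum fun j (_ : j ∈ Finset.univ) => hasSum_mul_conj_self (hA j) (hsumA j)
  simp only [RCLike.norm_conj] at h2
  rw [Complex.ofReal_sum]
  refine hasSum_of_eq h2 (fun p => ?_) rfl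
  obtain ⟨q, r⟩ := p
  simp only [A, map_mul, Complex.conj_conj, weylPhase_eq_pairing, conj_pairing, conj_exp2pi, neg_neg]
  -- Shifting `j` by the momentum frequency of `r` brings the two factors of `v` to the arguments
  -- `j` and `j - modVec N (sndFreq (q - r))`, as in `corr`.
  rw [← Equiv.sum_comp (Equiv.addRight (modVec N (sndFreq r))), corr, Finset.mul_sum, Finset.mul_sum]
  refine Finset.sum_congr rfl fun j _ => ?_
  simp only [Equiv.coe_addRight, add_sub_cancel_right]
  have e2 : j + modVec N (sndFreq r) - modVec N (sndFreq q) = j - modVec N (sndFreq (q - r)) := by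
    have : sndFreq (q - r) = sndFreq q - sndFreq r := rfl
    rw [this, modVec_sub]; abel
  have e3 : modVec N (fstFreq (q - r)) = modVec N (fstFreq q) - modVec N (fstFreq r) := modVec_sub _ _
  -- The Weyl relation: the half phases of `q` and `r` combine, with the character produced by the
  -- shift, into the half phase of `q - r` times the symplectic phase.
  have e4 : exp2pi (-((∑ i, (fstFreq (q - r) i : ℝ) * sndFreq (q - r) i) / (2 * N))) *
        exp2pi ((∑ i, ((fstFreq q i : ℝ) * sndFreq r i - fstFreq r i * sndFreq q i)) / (2 * N)) =
      exp2pi (-((∑ i, (fstFreq q i : ℝ) * sndFreq q i) / (2 * N))) *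
      exp2pi ((∑ i, (fstFreq r i : ℝ) * sndFreq r i) / (2 * N)) *
      pairing (modVec N (fstFreq (q - r))) (modVec N (sndFreq r)) := by
    rw [pairing_modVec, ← exp2pi_add, ← exp2pi_add, ← exp2pi_add]
    congr 1
    have e5 : ∑ i, (fstFreq (q - r) i : ℝ) * sndFreq (q - r) i =
        ∑ i, (fstFreq q i : ℝ) * sndFreq q i - ∑ i, (fstFreq q i : ℝ) * sndFreq r i
        - ∑ i, (fstFreq r i : ℝ) * sndFreq q i + ∑ i, (fstFreq r i : ℝ) * sndFreq r i := by
      rw [← Finset.sum_sub_distrib, ← Finset.sum_sub_distrib, ← Finset.sum_add_distrib]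
      refine Finset.sum_congr rfl fun i _ => ?_
      simp only [fstFreq, sndFreq, Pi.sub_apply]
      push_cast
      ring
    have e6 : ∑ i, (fstFreq (q - r) i : ℝ) * sndFreq r i =
        ∑ i, (fstFreq q i : ℝ) * sndFreq r i - ∑ i, (fstFreq r i : ℝ) * sndFreq r i := by
      rw [← Finset.sum_sub_distrib]
      refine Finset.sum_congr rfl fun i _ => ?_
      simp only [fstFreq, Pi.sub_apply]
      push_cast
      ring
    rw [e5, e6, Finset.sum_sub_distrib]
    field_simp
    ring
  have e7 : pairing (modVec N (fstFreq (q - r))) (modVec N (sndFreq r)) *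
      pairing (modVec N (fstFreq (q - r))) j =
      pairing (modVec N (fstFreq q)) (j + modVec N (sndFreq r)) *
      pairing (modVec N (fstFreq r)) (-(j + modVec N (sndFreq r))) := by
    rw [← pairing_add_right, e3, sub_eq_add_neg, pairing_add_left, pairing_neg_left, add_comm j]
  rw [e2, e4]
  linear_combination (c q * conj (c r) * exp2pi (-((∑ i, (fstFreq q i : ℝ) * sndFreq q i) / (2 * N))) *
      exp2pi ((∑ i, (fstFreq r i : ℝ) * sndFreq r i) / (2 * N)) *
      (conj (v (j - modVec N (sndFreq (q - r)))) * v j)) * e7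

/-- The coherent state average of `|f|²` as a double series in the Fourier coefficients of `f`. -/
lemma hasSum_coherent_average
    {f : EuclideanSpace ℝ (Fin n) × EuclideanSpace ℝ (Fin n) → ℂ}
    {c : (Fin n ⊕ Fin n → ℤ) → ℂ} (hc : Summable fun q => ‖c q‖)
    (hf : ∀ x ξ, HasSum (fun q => c q * exp2pi (⟪intVec (fstFreq q), x⟫ + ⟪intVec (sndFreq q), ξ⟫))
        (f (x, ξ))) (φ : ZMod N → ℝ) (v : (Fin n → ZMod N) → ℂ) :
    HasSum (fun p : (Fin n ⊕ Fin n → ℤ) × (Fin n ⊕ Fin n → ℤ) => c p.1 * conj (c p.2) *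
      (exp2pi (-((∑ i, (fstFreq (p.1 - p.2) i : ℝ) * sndFreq (p.1 - p.2) i) / (2 * N))) *
        (∏ i, weylExpect φ (fstFreq (p.1 - p.2) i) (sndFreq (p.1 - p.2) i)) *
        corr v (modVec N (fstFreq (p.1 - p.2))) (modVec N (sndFreq (p.1 - p.2)))))
      (((((N : ℝ) ^ n)⁻¹ * ∑ x, ∑ ξ, ‖f (residuePt x, residuePt ξ)‖ ^ 2 *
        ‖coherent (prodState n φ) x ξ v‖ ^ 2 : ℝ)) : ℂ) := by
  have hN : (N : ℂ) ^ n ≠ 0 := pow_ne_zero _ (by exact_mod_cast NeZero.ne N)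
  let A : (Fin n → ZMod N) → (Fin n → ZMod N) → (Fin n ⊕ Fin n → ℤ) → ℂ := fun x ξ q =>
    c q * (pairing (modVec N (fstFreq q)) x * pairing (modVec N (sndFreq q)) ξ)
  have hA : ∀ x ξ, Summable fun q => ‖A x ξ q‖ := fun x ξ => by
    simpa only [A, norm_mul, norm_pairing, mul_one] using hc
  have hsumA : ∀ x ξ, HasSum (A x ξ) (f (residuePt x, residuePt ξ)) := by
    intro x ξ
    have := hf (residuePt x) (residuePt ξ)
    simpa only [exp2pi_add, exp2pi_inner_residuePt] using this
  have h2 := (hasSum_sum fun x (_ : x ∈ Finset.univ) => hasSum_sum fun ξ (_ : ξ ∈ Finset.univ) =>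
    (hasSum_mul_conj_self (hA x ξ) (hsumA x ξ)).mul_right
      (coherent (prodState n φ) x ξ v * conj (coherent (prodState n φ) x ξ v))).mul_left
        (((N : ℂ) ^ n)⁻¹)
  push_cast
  refine hasSum_of_eq h2 (fun p => ?_) ?_
  · obtain ⟨q, r⟩ := p
    have e1 : ∀ x ξ, A x ξ q * conj (A x ξ r) *
        (coherent (prodState n φ) x ξ v * conj (coherent (prodState n φ) x ξ v)) =
        c q * conj (c r) * (pairing (modVec N (fstFreq (q - r))) x *
          pairing (modVec N (sndFreq (q - r))) ξ *
          (coherent (prodState n φ) x ξ v * conj (coherent (prodState n φ) x ξ v))) := by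
      intro x ξ
      have e2 : modVec N (fstFreq (q - r)) = modVec N (fstFreq q) - modVec N (fstFreq r) := modVec_sub _ _
      have e3 : modVec N (sndFreq (q - r)) = modVec N (sndFreq q) - modVec N (sndFreq r) := modVec_sub _ _
      rw [e2, e3]
      simp only [A, map_mul, conj_pairing, sub_eq_add_neg, pairing_add_left, pairing_neg_left]
      ring
    simp only [e1, ← Finset.mul_sum]
    rw [sum_coherent, prod_weylExpect]
    -- The half phase in the summand undoes the one contained in the product of expectations;
    -- keeping it there gives both series a common prefactor.
    have e4 : exp2pi (-((∑ i, (fstFreq (q - r) i : ℝ) * sndFreq (q - r) i) / (2 * N))) *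
        exp2pi ((∑ i, (fstFreq (q - r) i : ℝ) * sndFreq (q - r) i) / (2 * N)) = 1 := by
      rw [← exp2pi_add, neg_add_cancel]; simp [exp2pi]
    field_simp
    linear_combination (c q * conj (c r) * (∑ y, ((prodState n φ y *
      prodState n φ (y - modVec N (sndFreq (q - r))) : ℝ) : ℂ) *
        pairing (modVec N (fstFreq (q - r))) (-y)) *
      corr v (modVec N (fstFreq (q - r))) (modVec N (sndFreq (q - r)))) * e4
  · congr 1
    refine Finset.sum_congr rfl fun x _ => Finset.sum_congr rfl fun ξ _ => ?_
    rw [Complex.mul_conj']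
    push_cast
    rfl

end Expansion

/-! ### Comparison of `f_N f_N^*` with the coherent state quantization -/

section Comparison

open scoped RealInnerProductSpace ComplexConjugate

variable {n : ℕ}

/-- The symplectic form is at most the sum of the two weights; since these are at least `1`, the sum
is dominated by a product, the shape in which the double series can be summed. -/
lemma abs_sum_symplectic_le (q r : Fin n ⊕ Fin n → ℤ) :
    |∑ i, ((fstFreq q i : ℝ) * sndFreq r i - fstFreq r i * sndFreq q i)| ≤
      2 * (freqWeight q ^ 2 * freqWeight r ^ 2) := by
  have h1 : |∑ i, ((fstFreq q i : ℝ) * sndFreq r i - fstFreq r i * sndFreq q i)| ≤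
      freqWeight q + freqWeight r := by
    refine (Finset.abs_sum_le_sum_abs _ _).trans ?_
    have h2 : ∀ i, |(fstFreq q i : ℝ) * sndFreq r i - fstFreq r i * sndFreq q i| ≤
        ((fstFreq q i : ℝ) ^ 2 + (sndFreq q i : ℝ) ^ 2) +
          ((fstFreq r i : ℝ) ^ 2 + (sndFreq r i : ℝ) ^ 2) := by
      intro i
      set a := (fstFreq q i : ℝ)
      set b := (sndFreq q i : ℝ)
      set c := (fstFreq r i : ℝ)
      set d := (sndFreq r i : ℝ)
      rw [abs_le]
      constructor <;>
        nlinarith [sq_nonneg (a + d), sq_nonneg (a - d), sq_nonneg (b + c), sq_nonneg (b - c)]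
    refine (Finset.sum_le_sum fun i _ => h2 i).trans ?_
    rw [Finset.sum_add_distrib, Finset.sum_add_distrib, Finset.sum_add_distrib]
    unfold freqWeight
    rw [Fintype.sum_sum_type, Fintype.sum_sum_type]
    simp only [fstFreq, sndFreq]
    linarith
  refine h1.trans ?_
  have hq := one_le_freqWeight q
  have hr := one_le_freqWeight r
  have hq2 : freqWeight q ≤ freqWeight q ^ 2 := le_self_pow₀ hq two_ne_zero
  have hr2 : freqWeight r ≤ freqWeight r ^ 2 := le_self_pow₀ hr two_ne_zero
  nlinarith

lemma sum_frequency_error_le (q : Fin n ⊕ Fin n → ℤ) (N : ℝ) (hN : 0 < N) :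
    ∑ i, 104 * (1 + (fstFreq q i : ℝ) ^ 2) * (1 + (sndFreq q i : ℝ) ^ 2) / N ≤
      104 * n * freqWeight q ^ 2 / N := by
  have h : ∀ i ∈ Finset.univ, 104 * (1 + (fstFreq q i : ℝ) ^ 2) * (1 + (sndFreq q i : ℝ) ^ 2) / N ≤
      104 * freqWeight q ^ 2 / N := by
    intro i _
    rw [mul_assoc, sq (freqWeight q)]
    gcongr
    · exact zero_le_one.trans (one_le_freqWeight q)
    · exact one_add_sq_le_freqWeight q (Sum.inl i)
    · exact one_add_sq_le_freqWeight q (Sum.inr i)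
  refine (Finset.sum_le_card_nsmul _ _ _ h).trans_eq ?_
  simp
  ring

/-- `f_N f_N^*` agrees up to `O(1/N)` with the coherent state quantization of `|f|²`. -/
theorem IsSmoothOnTorus.exists_coherent_comparison
    {f : EuclideanSpace ℝ (Fin n) × EuclideanSpace ℝ (Fin n) → ℂ} (hf : IsSmoothOnTorus f) :
    ∃ D : ℝ, 0 ≤ D ∧ ∀ (N : ℕ) [NeZero N], ∃ Φ : (Fin n → ZMod N) → ℝ, ∑ j, Φ j ^ 2 = 1 ∧
      ∀ v : (Fin n → ZMod N) → ℂ,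
        |∑ j, ‖((quantize f N).conjTranspose.mulVec v) j‖ ^ 2 - ((N : ℝ) ^ n)⁻¹ *
          ∑ x, ∑ ξ, ‖f (residuePt x, residuePt ξ)‖ ^ 2 * ‖coherent Φ x ξ v‖ ^ 2| ≤
        D / N * ∑ j, ‖v j‖ ^ 2 := by
  obtain ⟨c, hcw, hsum⟩ := hf.fourier_weighted
  have hc := summable_norm_of_weighted hcw
  set a : (Fin n ⊕ Fin n → ℤ) → ℝ := fun q => ‖c q‖ * freqWeight q ^ 2 with ha
  have ha0 : ∀ q, 0 ≤ a q := fun q => by positivity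
  have hpair : Summable fun p : (Fin n ⊕ Fin n → ℤ) × (Fin n ⊕ Fin n → ℤ) => a p.1 * a p.2 :=
    hcw.mul_of_nonneg hcw ha0 ha0
  -- Here `7` bounds `2π` for the symplectic phase, and `416 = 104 · 2²` comes from the expectation
  -- error and the squared factor `2` in `freqWeight_sub_le`.
  refine ⟨(7 + 416 * n) * ∑' p : (Fin n ⊕ Fin n → ℤ) × (Fin n ⊕ Fin n → ℤ), a p.1 * a p.2,
    mul_nonneg (by positivity) (tsum_nonneg fun p => mul_nonneg (ha0 _) (ha0 _)), ?_⟩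
  intro N _
  have hN : (0 : ℝ) < N := by exact_mod_cast Nat.pos_of_ne_zero (NeZero.ne N)
  obtain ⟨φ, hφ, hexp⟩ := exists_weylExpect_near_one N
  refine ⟨prodState n φ, sum_prodState_sq hφ, fun v => ?_⟩
  set V := ∑ j, ‖v j‖ ^ 2 with hV
  have hV0 : 0 ≤ V := Finset.sum_nonneg fun _ _ => sq_nonneg _
  have hdiff := (hasSum_norm_conjTranspose_mulVec_sq hc hsum v).sub
    (hasSum_coherent_average hc hsum φ v)
  rw [← Complex.ofReal_sub] at hdiff
  rw [← Real.norm_eq_abs, ← Complex.norm_real, ← hdiff.tsum_eq]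
  have hbound := hpair.hasSum.mul_left ((7 + 416 * n) / N * V)
  refine (tsum_of_norm_bounded hbound fun p => ?_).trans_eq (by ring)
  obtain ⟨q, r⟩ := p
  dsimp only
  set E := exp2pi (-((∑ i, (fstFreq (q - r) i : ℝ) * sndFreq (q - r) i) / (2 * N)))
  set S := corr v (modVec N (fstFreq (q - r))) (modVec N (sndFreq (q - r)))
  set σ := ∑ i, ((fstFreq q i : ℝ) * sndFreq r i - fstFreq r i * sndFreq q i) with hσ
  set γ := ∏ i, weylExpect φ (fstFreq (q - r) i) (sndFreq (q - r) i)
  -- The two series differ only in the factors `exp(πiσ/N)` and `γ`, and both are compared with `1`.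
  have e1 : c q * conj (c r) * (E * exp2pi (σ / (2 * N)) * S) - c q * conj (c r) * (E * γ * S) =
      c q * conj (c r) * E * S * ((exp2pi (σ / (2 * N)) - 1) + (1 - γ)) := by ring
  have hS : ‖S‖ ≤ V := norm_corr_le _ _ _
  have hqr : 0 ≤ freqWeight q ^ 2 * freqWeight r ^ 2 := by positivity
  have h1 : ‖exp2pi (σ / (2 * N)) - 1‖ ≤ 7 * (freqWeight q ^ 2 * freqWeight r ^ 2) / N := by
    refine (norm_exp2pi_sub_one_le _).trans ?_
    rw [abs_div, abs_of_pos (by positivity : (0 : ℝ) < 2 * N)]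
    have h2 := abs_sum_symplectic_le q r
    rw [← hσ] at h2
    rw [mul_div_assoc', div_le_div_iff₀ (by positivity) hN]
    have hpi : 2 * Real.pi * |σ| ≤ 2 * (7 * (freqWeight q ^ 2 * freqWeight r ^ 2)) := by
      nlinarith [Real.pi_lt_d2, Real.pi_pos, abs_nonneg σ]
    nlinarith
  have h3 : ‖1 - γ‖ ≤ 416 * n * (freqWeight q ^ 2 * freqWeight r ^ 2) / N := by
    refine (norm_one_sub_prod_le _ _ fun i _ => norm_weylExpect_le_one hφ _ _).trans ?_
    refine (Finset.sum_le_sum fun i _ => hexp _ _).trans ?_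
    refine (sum_frequency_error_le (q - r) N hN).trans ?_
    have h4 : freqWeight (q - r) ^ 2 ≤ (2 * (freqWeight q * freqWeight r)) ^ 2 :=
      pow_le_pow_left₀ (zero_le_one.trans (one_le_freqWeight _)) (freqWeight_sub_le q r) 2
    calc 104 * n * freqWeight (q - r) ^ 2 / N
        ≤ 104 * n * (2 * (freqWeight q * freqWeight r)) ^ 2 / N := by gcongr
      _ = _ := by ring
  rw [e1]
  have hE : ‖E‖ = 1 := norm_exp2pi _
  rw [norm_mul, norm_mul, norm_mul, norm_mul, RCLike.norm_conj, hE, mul_one]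
  calc ‖c q‖ * ‖c r‖ * ‖S‖ * ‖exp2pi (σ / (2 * N)) - 1 + (1 - γ)‖
      ≤ ‖c q‖ * ‖c r‖ * V * (7 * (freqWeight q ^ 2 * freqWeight r ^ 2) / N +
          416 * n * (freqWeight q ^ 2 * freqWeight r ^ 2) / N) := by
        gcongr
        exact (norm_add_le _ _).trans (add_le_add h1 h3)
    _ = (7 + 416 * n) / N * V * (a q * a r) := by rw [ha]; ring

end Comparison

/-! ### Counting orthonormal vectors of small energy -/

section Counting

open scoped ComplexConjugate

variable {n N : ℕ} [NeZero N]

/-- Bessel's inequality for the pairing with a coherent state. -/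
lemma sum_norm_coherent_sq_le_one {ι : Type*} {Φ : (Fin n → ZMod N) → ℝ} (hΦ : ∑ j, Φ j ^ 2 = 1)
    {v : ι → EuclideanSpace ℂ (Fin n → ZMod N)} (hv : Orthonormal ℂ v) (s : Finset ι)
    (x ξ : Fin n → ZMod N) : ∑ i ∈ s, ‖coherent Φ x ξ (v i)‖ ^ 2 ≤ 1 := by
  -- The phase is conjugate to the one in `coherent`, because the inner product conjugates its first
  -- argument: `coherent Φ x ξ v` is the inner product of `u` with `v`.
  let u : EuclideanSpace ℂ (Fin n → ZMod N) :=
    WithLp.toLp 2 fun j => (Φ (j - x) : ℂ) * pairing ξ j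
  have hu : ‖u‖ ^ 2 = 1 := by
    rw [EuclideanSpace.norm_sq_eq, ← hΦ, ← Equiv.sum_comp (Equiv.subRight x) (fun j => Φ j ^ 2)]
    refine Finset.sum_congr rfl fun j _ => ?_
    simp [u, norm_pairing]
  have h := hv.sum_inner_products_le u (s := s)
  rw [hu] at h
  refine le_trans (le_of_eq (Finset.sum_congr rfl fun i _ => ?_)) h
  rw [← norm_inner_symm]
  congr 2
  simp only [PiLp.inner_apply, coherent, RCLike.inner_apply, u, map_mul, Complex.conj_ofReal,
    conj_pairing]
  exact Finset.sum_congr rfl fun j _ => by ring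

/-- The number of orthonormal vectors on which `‖f_N^* v‖²` is small is controlled by the number of
grid points at which `|f|²` is small. -/
lemma card_le_of_coherent_comparison {ι : Type*}
    {f : EuclideanSpace ℝ (Fin n) × EuclideanSpace ℝ (Fin n) → ℂ} {Φ : (Fin n → ZMod N) → ℝ}
    (hΦ : ∑ j, Φ j ^ 2 = 1) {δ E : ℝ} (hδ : 0 ≤ δ) (hE : 0 < E)
    (hcomp : ∀ v : (Fin n → ZMod N) → ℂ,
        |∑ j, ‖((quantize f N).conjTranspose.mulVec v) j‖ ^ 2 - ((N : ℝ) ^ n)⁻¹ *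
          ∑ x, ∑ ξ, ‖f (residuePt x, residuePt ξ)‖ ^ 2 * ‖coherent Φ x ξ v‖ ^ 2| ≤
        δ * ∑ j, ‖v j‖ ^ 2)
    {v : ι → EuclideanSpace ℂ (Fin n → ZMod N)} (hv : Orthonormal ℂ v) (s : Finset ι)
    (hs : ∀ i ∈ s, ∑ j, ‖((quantize f N).conjTranspose.mulVec (v i)) j‖ ^ 2 ≤ E) :
    (N : ℝ) ^ n * s.card ≤ 2 * ((Finset.univ.filter
      fun p : (Fin n → ZMod N) × (Fin n → ZMod N) =>
        ‖f (residuePt p.1, residuePt p.2)‖ ^ 2 ≤ 2 * (E + δ)).card : ℝ) := by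
  have hN : (0 : ℝ) < (N : ℝ) ^ n :=
    pow_pos (by exact_mod_cast Nat.pos_of_ne_zero (NeZero.ne N)) n
  set M := E + δ with hM
  have hM0 : 0 < M := by linarith
  set a : (Fin n → ZMod N) × (Fin n → ZMod N) → ℝ :=
    fun p => ‖f (residuePt p.1, residuePt p.2)‖ ^ 2 with ha
  set w : (Fin n → ZMod N) × (Fin n → ZMod N) → ℝ :=
    fun p => ∑ i ∈ s, ‖coherent Φ p.1 p.2 (v i)‖ ^ 2 with hw
  have hw0 : ∀ p, 0 ≤ w p := fun p => Finset.sum_nonneg fun _ _ => sq_nonneg _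
  have hw1 : ∀ p, w p ≤ 1 := fun p => sum_norm_coherent_sq_le_one hΦ hv s p.1 p.2
  have hnorm : ∀ i, ∑ j, ‖v i j‖ ^ 2 = 1 := fun i => by
    rw [← EuclideanSpace.norm_sq_eq, hv.1 i, one_pow]
  have hsum : ∑ p, w p = (N : ℝ) ^ n * s.card := by
    rw [hw, Finset.sum_comm]
    have : ∀ i ∈ s, ∑ p : (Fin n → ZMod N) × (Fin n → ZMod N), ‖coherent Φ p.1 p.2 (v i)‖ ^ 2 =
        (N : ℝ) ^ n := fun i _ => by
      rw [Fintype.sum_prod_type, sum_norm_coherent_sq hΦ, hnorm, mul_one]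
    rw [Finset.sum_congr rfl this, Finset.sum_const, nsmul_eq_mul, mul_comm]
  have haw : ∑ p, a p * w p ≤ (N : ℝ) ^ n * M * s.card := by
    simp only [hw, Finset.mul_sum]
    rw [Finset.sum_comm]
    have : ∀ i ∈ s, ∑ p : (Fin n → ZMod N) × (Fin n → ZMod N),
        a p * ‖coherent Φ p.1 p.2 (v i)‖ ^ 2 ≤ (N : ℝ) ^ n * M := by
      intro i hi
      have h1 := (abs_le.1 (hcomp (v i))).1
      rw [hnorm, mul_one] at h1
      have h2 := hs i hi
      rw [Fintype.sum_prod_type]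
      have h3 : ((N : ℝ) ^ n)⁻¹ * ∑ x, ∑ ξ, ‖f (residuePt x, residuePt ξ)‖ ^ 2 *
          ‖coherent Φ x ξ (v i)‖ ^ 2 ≤ M := by linarith
      rwa [inv_mul_le_iff₀ hN] at h3
    refine (Finset.sum_le_card_nsmul _ _ _ this).trans_eq ?_
    rw [nsmul_eq_mul, mul_comm]
  -- Chebyshev at height `2M`: the density `w` has values in `[0, 1]`, total mass `N^n · s.card`,
  -- and `a`-mean at most `M`. Hence at most half of the mass lies where `a > 2M`, and the rest is
  -- bounded by a number of points.
  have hpt : ∀ p, w p ≤ (if a p ≤ 2 * M then 1 else 0) + a p * w p / (2 * M) := by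
    intro p
    have ha0 : 0 ≤ a p := sq_nonneg _
    split_ifs with h
    · have : 0 ≤ a p * w p / (2 * M) := div_nonneg (mul_nonneg ha0 (hw0 p)) (by linarith)
      linarith [hw1 p]
    · rw [zero_add, le_div_iff₀ (by linarith), mul_comm]
      exact mul_le_mul_of_nonneg_right (not_le.1 h).le (hw0 p)
  have h1 := Finset.sum_le_sum fun p (_ : p ∈ Finset.univ) => hpt p
  rw [Finset.sum_add_distrib, ← Finset.sum_div, hsum, Finset.sum_boole] at h1
  have h2 : (∑ p, a p * w p) / (2 * M) ≤ (N : ℝ) ^ n * s.card / 2 := by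
    rw [div_le_div_iff₀ (by linarith) two_pos]
    nlinarith
  linarith

end Counting

/-! ### Rank and eigenvectors -/

section Rank

variable {ι : Type*} [Fintype ι] [DecidableEq ι]

/-- In an eigenbasis the real and imaginary parts recombine into the diagonal matrix of the values
of `ψ` at the eigenvalues, and these vanish off `K`. -/
lemma rank_matrixFun_le {A : Matrix ι ι ℂ} (hA : A.IsHermitian) (ψ : ℝ → ℂ) (K : Set ℝ)
    [DecidablePred (· ∈ K)] (hψ : ∀ t, t ∉ K → ψ t = 0) :
    (matrixFun ψ A).rank ≤ (Finset.univ.filter fun i => hA.eigenvalues i ∈ K).card := by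
  classical
  have h1 : matrixFun ψ A = (hA.eigenvectorUnitary : Matrix ι ι ℂ) *
      Matrix.diagonal (fun i => ψ (hA.eigenvalues i)) *
      (star hA.eigenvectorUnitary : Matrix ι ι ℂ) := by
    rw [matrixFun, hA.cfc_eq, hA.cfc_eq, Matrix.IsHermitian.cfc, Matrix.IsHermitian.cfc,
      Unitary.conjStarAlgAut_apply, Unitary.conjStarAlgAut_apply, ← Matrix.smul_mul,
      ← Matrix.mul_smul, ← Matrix.add_mul, ← Matrix.mul_add]
    congr 2
    rw [← Matrix.diagonal_smul, Matrix.diagonal_add]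
    congr 1
    funext i
    simp only [Pi.smul_apply, Function.comp_apply, smul_eq_mul]
    rw [mul_comm]
    exact Complex.re_add_im _
  rw [h1]
  refine (Matrix.rank_mul_le_left _ _).trans ((Matrix.rank_mul_le_right _ _).trans ?_)
  rw [Matrix.rank_diagonal, Fintype.card_subtype]
  refine Finset.card_le_card fun i hi => ?_
  rw [Finset.mem_filter] at hi ⊢
  refine ⟨hi.1, ?_⟩
  by_contra h
  exact hi.2 (hψ _ h)

/-- Pair the eigenvalue equation with the unit eigenvector and move `F` to the other side. This
turns a spectral condition into an energy bound. -/
lemma sum_norm_conjTranspose_mulVec_eigenvector {F : Matrix ι ι ℂ} {s : ℝ}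
    (hA : (s • (F * F.conjTranspose)).IsHermitian) (i : ι) :
    s * ∑ j, ‖(F.conjTranspose.mulVec (hA.eigenvectorBasis i)) j‖ ^ 2 = hA.eigenvalues i := by
  have h1 := hA.mulVec_eigenvectorBasis i
  set u : ι → ℂ := (hA.eigenvectorBasis i).ofLp with hu
  have h2 : star u ⬝ᵥ u = 1 := by
    have h3 : ‖hA.eigenvectorBasis i‖ ^ 2 = 1 := by
      rw [hA.eigenvectorBasis.orthonormal.1 i, one_pow]
    rw [EuclideanSpace.norm_sq_eq] at h3
    simp only [dotProduct, Pi.star_apply, Complex.star_def, Complex.conj_mul']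
    exact_mod_cast congrArg Complex.ofReal h3
  have h4 := congrArg (fun z => star u ⬝ᵥ z) h1
  simp only [Matrix.smul_mulVec, dotProduct_smul, h2] at h4
  rw [← Matrix.mulVec_mulVec, Matrix.dotProduct_mulVec] at h4
  have h5 : Matrix.vecMul (star u) F = star (F.conjTranspose.mulVec u) := by
    rw [Matrix.star_mulVec, Matrix.conjTranspose_conjTranspose]
  rw [h5] at h4
  simp only [dotProduct, Pi.star_apply, Complex.star_def, Complex.conj_mul'] at h4
  rw [Complex.real_smul, Complex.real_smul, mul_one] at h4
  exact_mod_cast h4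

end Rank

/-! ### From grid points to volumes of sublevel sets -/

section Volume

open MeasureTheory

variable {n : ℕ}

/-- The cube of side `1/N` with lower corner `x/N`. -/
def cell {N : ℕ} (x : Fin n → ZMod N) : Set (EuclideanSpace ℝ (Fin n)) :=
  {w | ∀ i, w i ∈ Set.Ico (((x i).val : ℝ) / N) (((x i).val + 1 : ℝ) / N)}

variable {N : ℕ} [NeZero N]

lemma cell_eq_preimage (x : Fin n → ZMod N) : cell x = (WithLp.ofLp : EuclideanSpace ℝ (Fin n) → _) ⁻¹'
    (Set.univ.pi fun i => Set.Ico (((x i).val : ℝ) / N) (((x i).val + 1 : ℝ) / N)) := by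
  ext w; simp [cell]

lemma measurableSet_cell (x : Fin n → ZMod N) : MeasurableSet (cell x) := by
  rw [cell_eq_preimage]
  exact (PiLp.volume_preserving_ofLp (Fin n)).measurable
    (MeasurableSet.univ_pi fun i => measurableSet_Ico)

lemma volume_cell (x : Fin n → ZMod N) : volume (cell x) = ENNReal.ofReal (((N : ℝ) ^ n)⁻¹) := by
  rw [cell_eq_preimage, (PiLp.volume_preserving_ofLp (Fin n)).measure_preimage
    (MeasurableSet.univ_pi fun i => measurableSet_Ico).nullMeasurableSet, volume_pi_pi]
  simp only [Real.volume_Ico]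
  have : ∀ i, ((x i).val + 1 : ℝ) / N - ((x i).val : ℝ) / N = (N : ℝ)⁻¹ := fun i => by ring
  simp only [this, Finset.prod_const, Finset.card_univ, Fintype.card_fin]
  rw [← ENNReal.ofReal_pow (by positivity), inv_pow]

lemma eq_of_mem_cell {x y : Fin n → ZMod N} {w : EuclideanSpace ℝ (Fin n)} (hx : w ∈ cell x)
    (hy : w ∈ cell y) : x = y := by
  have hN : (0 : ℝ) < N := by exact_mod_cast Nat.pos_of_ne_zero (NeZero.ne N)
  funext i
  apply ZMod.val_injective N
  have h1 := hx i
  have h2 := hy i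
  rw [Set.mem_Ico, div_le_iff₀ hN, lt_div_iff₀ hN] at h1 h2
  have h3 : ((x i).val : ℝ) < (y i).val + 1 := by linarith
  have h4 : ((y i).val : ℝ) < (x i).val + 1 := by linarith
  have h3' : (x i).val < (y i).val + 1 := by exact_mod_cast h3
  have h4' : (y i).val < (x i).val + 1 := by exact_mod_cast h4
  omega

lemma mem_Ico_of_mem_cell {x : Fin n → ZMod N} {w : EuclideanSpace ℝ (Fin n)} (hw : w ∈ cell x)
    (i : Fin n) : w i ∈ Set.Ico (0 : ℝ) 1 := by
  have hN : (0 : ℝ) < N := by exact_mod_cast Nat.pos_of_ne_zero (NeZero.ne N)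
  have h := hw i
  have h1 : ((x i).val : ℝ) + 1 ≤ N := by exact_mod_cast (ZMod.val_lt (x i))
  refine ⟨le_trans (by positivity) h.1, lt_of_lt_of_le h.2 ?_⟩
  rwa [div_le_one hN]

lemma residuePt_mem_cell (x : Fin n → ZMod N) : residuePt x ∈ cell x := by
  have hN : (0 : ℝ) < N := by exact_mod_cast Nat.pos_of_ne_zero (NeZero.ne N)
  intro i
  simp only [residuePt, gridPt, Int.cast_natCast]
  refine ⟨le_rfl, ?_⟩
  gcongr
  linarith

lemma norm_le_of_forall_abs_le {w : EuclideanSpace ℝ (Fin n)} {r : ℝ} (hr : 0 ≤ r)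
    (h : ∀ i, |w i| ≤ r) : ‖w‖ ≤ n * r := by
  rw [EuclideanSpace.norm_eq]
  refine Real.sqrt_le_iff.2 ⟨by positivity, ?_⟩
  have h1 : ∀ i ∈ Finset.univ, ‖w i‖ ^ 2 ≤ r ^ 2 := fun i _ =>
    pow_le_pow_left₀ (norm_nonneg _) (h i) 2
  refine (Finset.sum_le_card_nsmul _ _ _ h1).trans ?_
  rw [Finset.card_univ, Fintype.card_fin, nsmul_eq_mul, mul_pow]
  have h2 : (n : ℝ) ≤ (n : ℝ) ^ 2 := by exact_mod_cast Nat.le_self_pow two_ne_zero n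
  gcongr

lemma norm_sub_le_of_mem_cell {x : Fin n → ZMod N} {w w' : EuclideanSpace ℝ (Fin n)}
    (hw : w ∈ cell x) (hw' : w' ∈ cell x) : ‖w - w'‖ ≤ n / N := by
  have hN : (0 : ℝ) < N := by exact_mod_cast Nat.pos_of_ne_zero (NeZero.ne N)
  rw [div_eq_mul_inv]
  refine norm_le_of_forall_abs_le (by positivity) fun i => ?_
  have h1 := hw i
  have h2 := hw' i
  have h3 : ((x i).val + 1 : ℝ) / N - ((x i).val : ℝ) / N = (N : ℝ)⁻¹ := by ring
  rw [PiLp.sub_apply, abs_le]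
  constructor <;> linarith [h1.1, h1.2, h2.1, h2.2]

/-- The cube lies in a closed ball, compact and convex, so the derivative is bounded there and the
mean value inequality applies. -/
lemma exists_lipschitz_on_cube {f : EuclideanSpace ℝ (Fin n) × EuclideanSpace ℝ (Fin n) → ℂ}
    (hf : ContDiff ℝ ∞ f) : ∃ L : ℝ, 0 ≤ L ∧ ∀ w ∈ fundamentalCube n, ∀ w' ∈ fundamentalCube n,
      ‖f w - f w'‖ ≤ L * ‖w - w'‖ := by
  have hsub : fundamentalCube n ⊆ Metric.closedBall 0 (n : ℝ) := by
    intro w hw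
    rw [mem_closedBall_zero_iff, Prod.norm_def, max_le_iff]
    rw [← mul_one (n : ℝ)]
    refine ⟨norm_le_of_forall_abs_le zero_le_one fun i => ?_,
      norm_le_of_forall_abs_le zero_le_one fun i => ?_⟩
    · rw [abs_of_nonneg (hw i).1.1]; exact (hw i).1.2.le
    · rw [abs_of_nonneg (hw i).2.1]; exact (hw i).2.2.le
  obtain ⟨L, hL⟩ := (isCompact_closedBall (0 : EuclideanSpace ℝ (Fin n) × EuclideanSpace ℝ (Fin n))
    (n : ℝ)).exists_bound_of_continuousOn (hf.continuous_fderiv (by simp)).continuousOn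
  refine ⟨max L 0, le_max_right _ _, fun w hw w' hw' => ?_⟩
  exact (convex_closedBall _ _).norm_image_sub_le_of_norm_fderiv_le (𝕜 := ℝ)
    (fun z _ => hf.differentiable (by simp) z) (fun z hz => (hL z hz).trans (le_max_left _ _))
    (hsub hw') (hsub hw)

/-- The number of grid points in a sublevel set is controlled by the volume of a slightly larger
sublevel set. -/
lemma card_sublevel_le_volume {f : EuclideanSpace ℝ (Fin n) × EuclideanSpace ℝ (Fin n) → ℂ} {L : ℝ}
    (hL0 : 0 ≤ L) (hL : ∀ w ∈ fundamentalCube n, ∀ w' ∈ fundamentalCube n,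
      ‖f w - f w'‖ ≤ L * ‖w - w'‖) (s : Finset ((Fin n → ZMod N) × (Fin n → ZMod N))) {r : ℝ}
    (hs : ∀ p ∈ s, ‖f (residuePt p.1, residuePt p.2)‖ ≤ r) :
    ENNReal.ofReal (s.card * (((N : ℝ) ^ n)⁻¹ * ((N : ℝ) ^ n)⁻¹)) ≤
      volume {w | w ∈ fundamentalCube n ∧ ‖f w - 0‖ ≤ r + L * (n / N)} := by
  have hcube : ∀ p : (Fin n → ZMod N) × (Fin n → ZMod N), cell p.1 ×ˢ cell p.2 ⊆ fundamentalCube n :=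
    fun p w hw i => ⟨mem_Ico_of_mem_cell hw.1 i, mem_Ico_of_mem_cell hw.2 i⟩
  have hsub : (⋃ p ∈ s, cell p.1 ×ˢ cell p.2) ⊆
      {w | w ∈ fundamentalCube n ∧ ‖f w - 0‖ ≤ r + L * (n / N)} := by
    intro w hw
    obtain ⟨p, hp, hwp⟩ := Set.mem_iUnion₂.1 hw
    refine ⟨hcube p hwp, ?_⟩
    have hmem : (residuePt p.1, residuePt p.2) ∈ cell p.1 ×ˢ cell p.2 :=
      ⟨residuePt_mem_cell _, residuePt_mem_cell _⟩
    have h1 := hL w (hcube p hwp) _ (hcube p hmem)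
    have h2 : ‖w - (residuePt p.1, residuePt p.2)‖ ≤ n / N := by
      rw [Prod.norm_def, max_le_iff]
      exact ⟨norm_sub_le_of_mem_cell hwp.1 hmem.1, norm_sub_le_of_mem_cell hwp.2 hmem.2⟩
    have h3 := norm_le_norm_add_norm_sub' (f w) (f (residuePt p.1, residuePt p.2))
    rw [sub_zero]
    have h4 := mul_le_mul_of_nonneg_left h2 hL0
    linarith [hs p hp]
  refine le_trans (le_of_eq ?_) (measure_mono hsub)
  rw [measure_biUnion_finset]
  · have : ∀ p ∈ s, volume (cell p.1 ×ˢ cell p.2) =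
        ENNReal.ofReal (((N : ℝ) ^ n)⁻¹ * ((N : ℝ) ^ n)⁻¹) := fun p _ => by
      rw [Measure.volume_eq_prod, Measure.prod_prod, volume_cell, volume_cell,
        ENNReal.ofReal_mul (by positivity)]
    rw [Finset.sum_congr rfl this, Finset.sum_const, nsmul_eq_mul,
      ENNReal.ofReal_mul (by positivity), ENNReal.ofReal_natCast]
  · intro p _ q _ hpq
    refine Set.disjoint_left.2 fun w hw hw' => hpq ?_
    exact Prod.ext (eq_of_mem_cell hw.1 hw'.1) (eq_of_mem_cell hw.2 hw'.2)
  · exact fun p _ => (measurableSet_cell _).prod (measurableSet_cell _)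

end Volume

end TorusQuantization

end
-- The rank bound
open TorusQuantization in
theorem proposition2p9 (n : ℕ)
    (f : EuclideanSpace ℝ (Fin n) × EuclideanSpace ℝ (Fin n) → ℂ) (hf : IsSmoothOnTorus f)
    (κ : ℝ) (hκ : 0 < κ) (hvol : SublevelVolumeBound f 0 κ)
    (ρ : ℝ) (hρ : ρ < 1 / 2) (K : Set ℝ) (hK : IsCompact K) :
    ∃ C α₀ : ℝ, 0 < C ∧ 0 < α₀ ∧
      ∀ ψ : ℝ → ℂ, ContDiff ℝ ∞ ψ → tsupport ψ ⊆ K →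
        ∀ (N : ℕ) [NeZero N] (α : ℝ), (N : ℝ) ^ (-ρ) ≤ α → α ≤ α₀ →
          ((matrixFun ψ (((α ^ 2)⁻¹ : ℝ) • (quantize f N * (quantize f N).conjTranspose))).rank : ℝ)
            ≤ C * (N : ℝ) ^ n * α ^ κ := by
  classical
  obtain ⟨C₀, t₀, ht₀, hC₀⟩ := hvol
  obtain ⟨D, hD0, hD⟩ := hf.exists_coherent_comparison
  obtain ⟨L, hL0, hL⟩ := exists_lipschitz_on_cube hf.contDiff
  obtain ⟨R₀, hR₀⟩ := hK.bddAbove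
  set R : ℝ := max R₀ 1 with hR
  have hRpos : 0 < R := lt_of_lt_of_le one_pos (le_max_right _ _)
  have hKR : ∀ t ∈ K, t ≤ R := fun t ht => (hR₀ ht).trans (le_max_left _ _)
  -- The first summand is the threshold for `|f|` at grid points in units of `α`; the second
  -- accounts for the variation of `f` over a cell.
  set B : ℝ := Real.sqrt (2 * (R + D)) + L * n with hB
  have hBpos : 0 < B := add_pos_of_pos_of_nonneg (Real.sqrt_pos.2 (by linarith)) (by positivity)
  -- The maximum with `1` keeps the constant positive whatever the sign of `C₀`, and the factor `2`
  -- is the Chebyshev loss. The bound on `α` ensures `B α ≤ t₀`, where the volume hypothesis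
  -- applies, and `α² ≤ α`.
  refine ⟨2 * max C₀ 1 * B ^ κ, min 1 (t₀ / B), by positivity, by positivity, ?_⟩
  intro ψ _ hψ N _ α hα hα₀
  have hN1 : (1 : ℝ) ≤ N := by exact_mod_cast Nat.one_le_iff_ne_zero.2 (NeZero.ne N)
  have hN : (0 : ℝ) < N := by linarith
  have hNn : (0 : ℝ) < (N : ℝ) ^ n := by positivity
  have hαpos : 0 < α := lt_of_lt_of_le (by positivity) hα
  have hα1 : α ≤ 1 := hα₀.trans (min_le_left _ _)
  -- This is where `ρ < 1/2` enters: the comparison error `D/N` is absorbed into the energy scale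
  -- `α²`.
  have hNα : 1 / (N : ℝ) ≤ α ^ 2 := by
    have h1 : (N : ℝ) ^ (-(1 / 2) : ℝ) ≤ α :=
      (Real.rpow_le_rpow_of_exponent_le hN1 (by linarith)).trans hα
    have h2 : ((N : ℝ) ^ (-(1 / 2) : ℝ)) ^ 2 = 1 / N := by
      rw [← Real.rpow_natCast, ← Real.rpow_mul hN.le]
      norm_num
      rw [Real.rpow_neg_one]
    rw [← h2]
    exact pow_le_pow_left₀ (by positivity) h1 2
  obtain ⟨Φ, hΦ, hcomp⟩ := hD N
  have hA : (((α ^ 2)⁻¹ : ℝ) • (quantize f N * (quantize f N).conjTranspose)).IsHermitian := by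
    have h := Matrix.isHermitian_mul_conjTranspose_self (quantize f N)
    rw [Matrix.IsHermitian, Matrix.conjTranspose_smul, h.eq, star_trivial]
  set s := Finset.univ.filter fun i => hA.eigenvalues i ∈ K with hs
  have hrank := rank_matrixFun_le hA ψ K fun t ht => by
    by_contra h
    exact ht (hψ (subset_tsupport ψ h))
  have hsmall : ∀ i ∈ s, ∑ j, ‖((quantize f N).conjTranspose.mulVec (hA.eigenvectorBasis i)) j‖ ^ 2 ≤
      R * α ^ 2 := by
    intro i hi
    have h1 := sum_norm_conjTranspose_mulVec_eigenvector hA i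
    have h2 := hKR _ (Finset.mem_filter.1 hi).2
    rw [← h1, inv_mul_le_iff₀ (by positivity), mul_comm] at h2
    exact h2
  have hcount := card_le_of_coherent_comparison hΦ (by positivity) (by positivity) hcomp
    hA.eigenvectorBasis.orthonormal s hsmall
  set T := Finset.univ.filter fun p : (Fin n → ZMod N) × (Fin n → ZMod N) =>
        ‖f (residuePt p.1, residuePt p.2)‖ ^ 2 ≤ 2 * (R * α ^ 2 + D / N)
  have hT : ∀ p ∈ T, ‖f (residuePt p.1, residuePt p.2)‖ ≤ Real.sqrt (2 * (R + D)) * α := by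
    intro p hp
    have h1 := (Finset.mem_filter.1 hp).2
    rw [← Real.sqrt_sq hαpos.le, ← Real.sqrt_mul (by linarith)]
    refine Real.le_sqrt_of_sq_le (h1.trans ?_)
    have h2 : D / N ≤ D * α ^ 2 := by
      rw [div_eq_mul_one_div]
      exact mul_le_mul_of_nonneg_left hNα hD0
    linarith
  have hvolT := card_sublevel_le_volume hL0 hL T hT
  have hle : Real.sqrt (2 * (R + D)) * α + L * (n / N) ≤ B * α := by
    have h1 : (n : ℝ) / N ≤ n * α := by
      rw [div_eq_mul_one_div]
      refine mul_le_mul_of_nonneg_left (hNα.trans ?_) (by positivity)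
      nlinarith
    have h2 := mul_le_mul_of_nonneg_left h1 hL0
    rw [hB]
    linarith
  have hBt : B * α ≤ t₀ := by
    have := hα₀.trans (min_le_right _ _)
    rwa [le_div_iff₀ hBpos, mul_comm] at this
  have hfin := (hvolT.trans (MeasureTheory.measure_mono
    (t := {w | w ∈ fundamentalCube n ∧ ‖f w - 0‖ ≤ B * α}) fun w hw => ⟨hw.1, hw.2.trans hle⟩)).trans
    (hC₀ (B * α) (by positivity) hBt)
  have hBα : 0 < (B * α) ^ κ := by positivity
  have hfin' : (T.card : ℝ) * (((N : ℝ) ^ n)⁻¹ * ((N : ℝ) ^ n)⁻¹) ≤ max C₀ 1 * (B * α) ^ κ := by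
    rw [← ENNReal.ofReal_le_ofReal_iff (by positivity)]
    refine hfin.trans (ENNReal.ofReal_le_ofReal ?_)
    exact mul_le_mul_of_nonneg_right (le_max_left _ _) hBα.le
  have hTcard : (T.card : ℝ) ≤ max C₀ 1 * (B * α) ^ κ * ((N : ℝ) ^ n * (N : ℝ) ^ n) := by
    rwa [← mul_inv, ← div_eq_mul_inv, div_le_iff₀ (by positivity)] at hfin'
  have hscard : (s.card : ℝ) ≤ 2 * max C₀ 1 * B ^ κ * (N : ℝ) ^ n * α ^ κ := by
    rw [Real.mul_rpow hBpos.le hαpos.le] at hTcard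
    refine le_of_mul_le_mul_left ?_ hNn
    calc (N : ℝ) ^ n * s.card ≤ 2 * T.card := hcount
      _ ≤ 2 * (max C₀ 1 * (B ^ κ * α ^ κ) * ((N : ℝ) ^ n * (N : ℝ) ^ n)) := by gcongr
      _ = _ := by ring
  exact le_trans (by exact_mod_cast hrank) hscard
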